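/- Let $n,m,k,l$ be non-negative integers with $m,k\le n$ and $m+k-n\le l\le \min(m,k)$, and put $M:=m-l$, $N:=n-m-k+l$. Let $$|\Xi_{n,m|k,l}\rangle := |1^l\,0^{k-l}\rangle\otimes|\Xi_{N+M,M}\rangle\in(\mathbb C^2)^{\otimes n},$$ where $|1^l0^{k-l}\rangle=|1\rangle^{\otimes l}\otimes|0\rangle^{\otimes(k-l)}$ and $|\Xi_{N+M,M}\rangle=\binom{N+M}{M}^{-1/2}\sum|w\rangle$ is the normalized sum over all words $w\in\{0,1\}^{N+M}$ with exactly $M$ letters $1$. Let the symmetric group $\mathfrak S_n$ act on $(\mathbb C^2)^{\otimes n}$ by permuting the tensor factors. For $0\le x\le\lfloor n/2\rfloor$ let $\mathsf P_{(n-x,x)}$ be the orthogonal projector of $(\mathbb C^2)^{\otimes n}$ onto the isotypic component of the irreducible representation $\mathcal V_{(n-x,x)}$ of $\mathfrak S_n$ corresponding to the partition $(n-x,x)$. Put $$p(x):=\langle\Xi_{n,m|k,l}|\,\mathsf P_{(n-x,x)}\,|\Xi_{n,m|k,l}\rangle,$$ with $p(x):=0$ for $x>\lfloor n/2\rfloor$,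 and let $s(x):=\sum_{u=0}^{x}p(u)$ be the cumulative distribution function. Write $(a)_i:=a(a+1)\cdots(a+i-1)$ and $${}_4F_3\!\left[{a_1,a_2,a_3,a_4\atop b_1,b_2,b_3};z\right]:=\sum_{i\ge0}\frac{(a_1)_i(a_2)_i(a_3)_i(a_4)_i}{(1)_i(b_1)_i(b_2)_i(b_3)_i}z^i,$$ where terms with vanishing numerator are read as $0$. Assume $m\le n-m$. Then: 1. $s(x)=s(\min(x,m))$ for all integers $x\ge0$. 2. For all integers $0\le x\le m$, $$s(x)=\binom{n-k}{m-l}\frac{\binom nx}{\binom nm}\;{}_4F_3\!\left[{-x,\;x-n,\;-M,\;-N\atop -m,\;m-n,\;-M-N};1\right].$$ 3. $s(m)=1$. 4. For all integers $0\le x\le m$, $$\sum_{u=0}^{x}\binom nu\frac{n-2u+1}{n-u+1}\;{}_4F_3\!\left[{-u,\;u-n-1,\;-M,\;-N\atop -m,\;m-n,\;-M-N};1\right]=\binom nx\;{}_4F_3\!\left[{-x,\;x-n,\;-M,\;-N\atop -m,\;m-n,\;-M-N};1\right].$$ -/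

import Mathlib

/-- The `n`-qubit space `(ℂ²)^{⊗n}` with its standard Hermitian form, in coordinates with respect to
the orthonormal basis `|i₁ ⋯ iₙ⟩` indexed by words `w : Fin n → Fin 2`. -/
abbrev Qubits (n : ℕ) : Type := EuclideanSpace ℂ (Fin n → Fin 2)

/-- The basis vector `|w⟩ = |w₁ ⋯ wₙ⟩`. -/
noncomputable def ket {n : ℕ} (w : Fin n → Fin 2) : Qubits n :=
  EuclideanSpace.single w 1

/-- The permutation action of `𝔖ₙ` on tensor factors,
`π(g) |i₁ ⋯ iₙ⟩ = |i_{g⁻¹(1)} ⋯ i_{g⁻¹(n)}⟩` (see `permRep_ket`). -/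
noncomputable def permRep (n : ℕ) : Representation ℂ (Equiv.Perm (Fin n)) (Qubits n) where
  toFun g :=
    { toFun := fun ψ => WithLp.toLp 2 fun w => ψ (w ∘ g)
      map_add' := fun _ _ => rfl
      map_smul' := fun _ _ => rfl }
  map_one' := rfl
  map_mul' _ _ := rfl

theorem permRep_ket {n : ℕ} (g : Equiv.Perm (Fin n)) (w : Fin n → Fin 2) :
    permRep n g (ket w) = ket (fun j => w (g⁻¹ j)) := by
  ext v
  have h : v ∘ g = w ↔ v = fun j => w (g⁻¹ j) := by
    constructor
    · rintro rfl
      funext j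
      simp
    · rintro rfl
      funext j
      simp
  change (EuclideanSpace.single w (1 : ℂ) : Qubits n) (v ∘ g) =
    (EuclideanSpace.single (fun j => w (g⁻¹ j)) (1 : ℂ) : Qubits n) v
  simp only [PiLp.single_apply, h]

/-- The tensor product `ψ ⊗ φ ∈ (ℂ²)^{⊗n}` of `ψ ∈ (ℂ²)^{⊗a}` and `φ ∈ (ℂ²)^{⊗b}`, `a + b = n`. -/
noncomputable def tensor {a b n : ℕ} (h : a + b = n) (ψ : Qubits a) (φ : Qubits b) : Qubits n :=
  WithLp.toLp 2 fun w =>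
    ψ (fun i => w (Fin.cast h (Fin.castAdd b i))) * φ (fun j => w (Fin.cast h (Fin.natAdd a j)))

/-- The vector `|1^l 0^(k-l)⟩ ∈ (ℂ²)^{⊗k}`. -/
noncomputable def ketOnesZeros (k l : ℕ) : Qubits k :=
  ket fun i => if (i : ℕ) < l then 1 else 0

/-- The Dicke state: the normalized sum of the `binom r M` distinct permutations of
`|1^M 0^(r-M)⟩`, i.e. of all `|w⟩` with exactly `M` letters `1`. -/
noncomputable def dicke (r M : ℕ) : Qubits r :=
  ((Real.sqrt (r.choose M) : ℂ))⁻¹ •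
    ∑ w : Fin r → Fin 2 with (Finset.univ.filter fun j => w j = 1).card = M, ket w

/-- The range of the parameters `(n, m, k, l)`:
`m, k ≤ n` and `m + k - n ≤ l ≤ min m k`. -/
structure Admissible (n m k l : ℕ) : Prop where
  m_le : m ≤ n
  k_le : k ≤ n
  add_le : m + k ≤ n + l
  l_le_m : l ≤ m
  l_le_k : l ≤ k

/-- The state `Ξ_{n,m|k,l} = |1^l 0^(k-l)⟩ ⊗ Ξ_{N+M,M}`, where `M = m - l` and `N + M = n - k`. -/
noncomputable def xi {n m k l : ℕ} (h : Admissible n m k l) : Qubits n :=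
  tensor (Nat.add_sub_cancel' h.k_le) (ketOnesZeros k l) (dicke (n - k) (m - l))

/-- The word with letter `1` at `a i` for `i ∈ s` and at `b i` for `i ∉ s`, and `0` elsewhere. -/
noncomputable def columnWord {n x : ℕ} (a b : Fin x → Fin n) (s : Finset (Fin x)) :
    Fin n → Fin 2 := by
  classical exact fun j => if (∃ i ∈ s, a i = j) ∨ (∃ i, i ∉ s ∧ b i = j) then 1 else 0

/-- The polytabloid of a tableau of shape `(n-x, x)`. A tabloid is encoded by the word having letter
`1` exactly at the entries of the second row. The `i`-th of the first `x` columns has top entry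
`a i` and bottom entry `b i`; the column group consists of the products, over `i ∈ s`, of the
transpositions `(a i  b i)`, with sign `(-1)^|s|`. -/
noncomputable def polytabloid {n x : ℕ} (a b : Fin x → Fin n) : Qubits n :=
  ∑ s : Finset (Fin x), (-1 : ℂ) ^ s.card • ket (columnWord a b s)

theorem permRep_polytabloid {n x : ℕ} (g : Equiv.Perm (Fin n)) (a b : Fin x → Fin n) :
    permRep n g (polytabloid a b) = polytabloid (g ∘ a) (g ∘ b) := by
  simp only [polytabloid, map_sum, map_smul, permRep_ket]
  refine Finset.sum_congr rfl fun s _ => ?_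
  congr 2
  funext j
  simp [columnWord, Equiv.eq_symm_apply]

/-- The Specht module `𝒱_(n-x,x)`, the irreducible representation of `𝔖ₙ` corresponding to the
partition `(n-x, x)`, `2x ≤ n`: the span of all polytabloids of that shape. The entries of the first
`x` columns are pairwise distinct (so for `2x > n` there are none, and the module is zero). -/
noncomputable def specht (n x : ℕ) : Subrepresentation (permRep n) where
  toSubmodule := Submodule.span ℂ
    {v | ∃ a b : Fin x → Fin n, Function.Injective (Sum.elim a b) ∧ v = polytabloid a b}
  apply_mem_toSubmodule g v hv := by
    induction hv using Submodule.span_induction with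
    | mem v hv =>
      obtain ⟨a, b, hab, rfl⟩ := hv
      rw [permRep_polytabloid]
      refine Submodule.subset_span ⟨g ∘ a, g ∘ b, ?_, rfl⟩
      rw [← Sum.comp_elim]
      exact g.injective.comp hab
    | zero => simp
    | add u v _ _ hu hv => rw [map_add]; exact Submodule.add_mem _ hu hv
    | smul c v _ hv => rw [map_smul]; exact Submodule.smul_mem _ c hv

/-- The isotypic component of type `𝒱_(n-x,x)` in `(ℂ²)^{⊗n}`: the sum of all subrepresentations
of `𝔖ₙ` isomorphic to `𝒱_(n-x,x)`. -/
noncomputable def isotypic (n x : ℕ) : Submodule ℂ (Qubits n) :=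
  (Subrepresentation.ofSubmodule' (isotypicComponent (MonoidAlgebra ℂ (Equiv.Perm (Fin n)))
    (permRep n).asModule (specht n x).asSubmodule)).toSubmodule

/-- The probability mass function `p(x) = ⟨Ξ| P_(n-x,x) |Ξ⟩`, where `P_(n-x,x)` is the orthogonal
projector onto the isotypic component. -/
noncomputable def pmf {n m k l : ℕ} (h : Admissible n m k l) (x : ℕ) : ℂ :=
  inner ℂ (xi h) ((isotypic n x).starProjection (xi h))

/-- The cumulative distribution function `s(x) = ∑_{u=0}^x p(u)`. -/
noncomputable def cdf {n m k l : ℕ} (h : Admissible n m k l) (x : ℕ) : ℂ :=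
  ∑ u ∈ Finset.range (x + 1), pmf h u

/-- The raising factorial `(a)_r = a (a+1) ⋯ (a+r-1)`. -/
noncomputable def risingFactorial (a : ℂ) (r : ℕ) : ℂ :=
  ∏ j ∈ Finset.range r, (a + j)

/-- The generalized hypergeometric series with numerator parameters `as`, denominator parameters
`bs` and argument `z`. If some numerator parameter is `-x`, `x : ℕ`, all terms with index `> x`
vanish. -/
noncomputable def hypergeom (as bs : List ℂ) (z : ℂ) : ℂ :=
  ∑' i : ℕ, (as.map fun a => risingFactorial a i).prod /
    (risingFactorial 1 i * (bs.map fun b => risingFactorial b i).prod) * z ^ i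

/-! Write `E = lower` and `F = raise` for the two adjoint operators that change one letter. They
commute with the permutations, shift the weight (the number of letters 1) by one, and on weight `u`
satisfy `EF - FE = n - 2u`. Call a vector of weight `u` primitive if `E` kills it.

Since `ker E` is the orthogonal complement of the range of `F`, every vector of weight `m` is a sum
of vectors `F^(m-u) v_u` with `v_u` primitive and `u ≤ m`. The primitive vectors of weight `u` are
exactly the Specht module (`specht_eq_primitive`). For `2m ≤ n` the summand `F^(m-u) v_u` lies in
the isotypic component of `u` and is orthogonal to all the others. Hence it is the projection of the
vector, and `p(u) = ⟨Ξ, F^(m-u) v_u⟩` for `u ≤ m`, while `p(u) = 0` for `u > m`. This gives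
statements 1 and 3.

For statement 2 the moments `⟨Ξ|F^(m-q) E^(m-q)|Ξ⟩` are computed twice (`sum_pmf_mul_choose`):
through the eigenvalues on the summands, and by counting common `q`-subsets of pairs of supports
`S`, `S'` of words in `Ξ`. An alternating sum over `q` replaces `|S ∩ S'|` by `|S \ S'|`. The count
then has a closed form, and the linear system for `p` becomes triangular (`sum_pmf_mul_eigenvalue`).
Its inversion yields the partial sums of `p` directly (`sum_range_eq_of_triangular`), and these are
the hypergeometric terms.

Statement 4 is independent of all this: it holds term by term in the series, by telescoping in `x`
(`sum_range_choose_mul_risingFactorial`). -/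

namespace Qubits

open Finset

/-! ### The raising and lowering operators and the decomposition into strings of primitive vectors.
-/

section

variable {n : ℕ}

/-- The number of letters `1` of a word. -/
def weight (w : Fin n → Fin 2) : ℕ := (univ.filter fun j => w j = 1).card

/-- Change the `j`-th letter of a word. -/
def flip (j : Fin n) (w : Fin n → Fin 2) : Fin n → Fin 2 := Function.update w j (w j + 1)

@[simp] theorem flip_same (j : Fin n) (w : Fin n → Fin 2) : flip j w j = w j + 1 := by
  simp [flip]

theorem flip_of_ne {i j : Fin n} (h : i ≠ j) (w : Fin n → Fin 2) : flip j w i = w i := by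
  simp [flip, h]

@[simp] theorem flip_flip (j : Fin n) (w : Fin n → Fin 2) : flip j (flip j w) = w := by
  funext i
  by_cases h : i = j
  · subst h
    rw [flip_same, flip_same]
    omega
  · rw [flip_of_ne h, flip_of_ne h]

theorem flip_comm (i j : Fin n) (w : Fin n → Fin 2) : flip i (flip j w) = flip j (flip i w) := by
  by_cases hij : i = j
  · rw [hij]
  funext k
  by_cases hi : k = i
  · subst hi
    rw [flip_same, flip_of_ne hij, flip_of_ne hij, flip_same]
  · by_cases hj : k = j
    · subst hj
      rw [flip_same, flip_of_ne hi, flip_of_ne hi, flip_same]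
    · rw [flip_of_ne hi, flip_of_ne hj, flip_of_ne hj, flip_of_ne hi]

/-- `flip j` as a permutation of the set of words. -/
def flipEquiv (j : Fin n) : (Fin n → Fin 2) ≃ (Fin n → Fin 2) where
  toFun := flip j
  invFun := flip j
  left_inv := flip_flip j
  right_inv := flip_flip j

theorem flip_comp (g : Equiv.Perm (Fin n)) (j : Fin n) (w : Fin n → Fin 2) :
    flip j (w ∘ g) = flip (g j) w ∘ g := by
  funext i
  by_cases h : i = j
  · subst h
    simp
  · rw [flip_of_ne h, Function.comp_apply, Function.comp_apply,
      flip_of_ne (fun h' => h (g.injective h'))]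

theorem weight_flip_of_eq_zero {j : Fin n} {w : Fin n → Fin 2} (h : w j = 0) :
    weight (flip j w) = weight w + 1 := by
  unfold weight
  have : (univ.filter fun i => flip j w i = 1) = insert j (univ.filter fun i => w i = 1) := by
    ext i
    by_cases hi : i = j
    · subst hi
      simp [h]
    · simp [flip_of_ne hi, hi]
  rw [this, card_insert_of_notMem (by simp [h])]

theorem weight_flip_of_eq_one {j : Fin n} {w : Fin n → Fin 2} (h : w j = 1) :
    weight (flip j w) + 1 = weight w := by
  have := weight_flip_of_eq_zero (j := j) (w := flip j w) (by simp [h])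
  rw [flip_flip] at this
  exact this.symm

theorem weight_comp (g : Equiv.Perm (Fin n)) (w : Fin n → Fin 2) :
    weight (w ∘ g) = weight w := by
  unfold weight
  refine card_bij (fun i _ => g i) (by simp) (by simp) fun i hi => ⟨g.symm i, ?_, by simp⟩
  simpa using hi

/-- The operator summing `|0⟩⟨1|` over all tensor factors. -/
noncomputable def lower (n : ℕ) : Qubits n →ₗ[ℂ] Qubits n where
  toFun ψ := WithLp.toLp 2 fun w => ∑ j, if w j = 0 then ψ (flip j w) else 0
  map_add' ψ φ := by
    ext w
    simp only [PiLp.add_apply, ← sum_add_distrib]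
    exact sum_congr rfl fun j _ => by split_ifs <;> simp
  map_smul' c ψ := by
    ext w
    simp [mul_sum]

/-- The operator summing `|1⟩⟨0|` over all tensor factors. -/
noncomputable def raise (n : ℕ) : Qubits n →ₗ[ℂ] Qubits n where
  toFun ψ := WithLp.toLp 2 fun w => ∑ j, if w j = 1 then ψ (flip j w) else 0
  map_add' ψ φ := by
    ext w
    simp only [PiLp.add_apply, ← sum_add_distrib]
    exact sum_congr rfl fun j _ => by split_ifs <;> simp
  map_smul' c ψ := by
    ext w
    simp [mul_sum]

theorem lower_apply (ψ : Qubits n) (w : Fin n → Fin 2) :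
    lower n ψ w = ∑ j, if w j = 0 then ψ (flip j w) else 0 := rfl

theorem raise_apply (ψ : Qubits n) (w : Fin n → Fin 2) :
    raise n ψ w = ∑ j, if w j = 1 then ψ (flip j w) else 0 := rfl

theorem inner_eq_sum (ψ φ : Qubits n) : inner ℂ ψ φ = ∑ w, starRingEnd ℂ (ψ w) * φ w := by
  simp [PiLp.inner_apply, mul_comm]

/-- For each `j`, the involution `flip j` on words exchanges the terms with letter 0 at `j` and
those with letter 1. -/
theorem inner_lower_left (ψ φ : Qubits n) :
    inner ℂ (lower n ψ) φ = inner ℂ ψ (raise n φ) := by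
  simp only [inner_eq_sum, lower_apply, raise_apply, map_sum, sum_mul, mul_sum]
  rw [sum_comm, sum_comm (s := univ (α := Fin n → Fin 2))]
  refine sum_congr rfl fun j _ => ?_
  rw [← Equiv.sum_comp (flipEquiv j)]
  refine sum_congr rfl fun w _ => ?_
  have h : flipEquiv j w = flip j w := rfl
  simp only [h, flip_same, flip_flip]
  rcases (by omega : w j = 0 ∨ w j = 1) with hw | hw <;> simp [hw]

theorem inner_raise_left (ψ φ : Qubits n) :
    inner ℂ (raise n ψ) φ = inner ℂ ψ (lower n φ) := by
  rw [← inner_conj_symm, ← inner_lower_left, inner_conj_symm]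

theorem inner_lower_pow_left (j : ℕ) (ψ φ : Qubits n) :
    inner ℂ ((lower n ^ j) ψ) φ = inner ℂ ψ ((raise n ^ j) φ) := by
  induction j generalizing ψ with
  | zero => simp
  | succ j ih =>
    rw [pow_succ, Module.End.mul_apply, ih, inner_lower_left, ← Module.End.mul_apply, ← pow_succ']

theorem permRep_apply (g : Equiv.Perm (Fin n)) (ψ : Qubits n) (w : Fin n → Fin 2) :
    permRep n g ψ w = ψ (w ∘ g) := rfl

theorem inner_permRep (g : Equiv.Perm (Fin n)) (ψ φ : Qubits n) :
    inner ℂ (permRep n g ψ) (permRep n g φ) = inner ℂ ψ φ := by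
  simp only [inner_eq_sum, permRep_apply]
  exact Equiv.sum_comp (Equiv.arrowCongr g.symm (Equiv.refl (Fin 2)))
    fun w => starRingEnd ℂ (ψ w) * φ w

theorem lower_permRep (g : Equiv.Perm (Fin n)) (ψ : Qubits n) :
    lower n (permRep n g ψ) = permRep n g (lower n ψ) := by
  ext w
  simp only [lower_apply, permRep_apply, flip_comp]
  exact (Equiv.sum_comp g fun j => if w j = 0 then ψ (flip j w ∘ g) else 0).symm

theorem raise_permRep (g : Equiv.Perm (Fin n)) (ψ : Qubits n) :
    raise n (permRep n g ψ) = permRep n g (raise n ψ) := by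
  ext w
  simp only [raise_apply, permRep_apply, flip_comp]
  exact (Equiv.sum_comp g fun j => if w j = 1 then ψ (flip j w ∘ g) else 0).symm

theorem lower_pow_permRep (j : ℕ) (g : Equiv.Perm (Fin n)) (ψ : Qubits n) :
    (lower n ^ j) (permRep n g ψ) = permRep n g ((lower n ^ j) ψ) := by
  induction j with
  | zero => rfl
  | succ j ih => rw [pow_succ', Module.End.mul_apply, ih, lower_permRep, Module.End.mul_apply]

theorem raise_pow_permRep (j : ℕ) (g : Equiv.Perm (Fin n)) (ψ : Qubits n) :
    (raise n ^ j) (permRep n g ψ) = permRep n g ((raise n ^ j) ψ) := by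
  induction j with
  | zero => rfl
  | succ j ih => rw [pow_succ', Module.End.mul_apply, ih, raise_permRep, Module.End.mul_apply]

/-- The span of the basis vectors `|w⟩` with `w` of weight `u`. -/
def weightSpace (n u : ℕ) : Submodule ℂ (Qubits n) where
  carrier := {ψ | ∀ w, weight w ≠ u → ψ w = 0}
  add_mem' hψ hφ w hw := by simp [hψ w hw, hφ w hw]
  zero_mem' _ _ := rfl
  smul_mem' c ψ hψ w hw := by simp [hψ w hw]

theorem ket_mem_weightSpace (w : Fin n → Fin 2) : ket w ∈ weightSpace n (weight w) := by
  intro v hv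
  have : v ≠ w := fun h => hv (h ▸ rfl)
  simp [ket, this]

theorem permRep_mem_weightSpace {u : ℕ} (g : Equiv.Perm (Fin n)) {ψ : Qubits n}
    (h : ψ ∈ weightSpace n u) : permRep n g ψ ∈ weightSpace n u := fun w hw =>
  h _ (by rwa [weight_comp])

theorem lower_mem_weightSpace {u : ℕ} {ψ : Qubits n} (h : ψ ∈ weightSpace n (u + 1)) :
    lower n ψ ∈ weightSpace n u := by
  intro w hw
  rw [lower_apply]
  refine sum_eq_zero fun j _ => ?_
  split_ifs with hj
  · exact h _ (by rw [weight_flip_of_eq_zero hj]; omega)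
  · rfl

theorem lower_eq_zero_of_mem_weightSpace_zero {ψ : Qubits n} (h : ψ ∈ weightSpace n 0) :
    lower n ψ = 0 := by
  ext w
  rw [lower_apply]
  refine sum_eq_zero fun j _ => ?_
  split_ifs with hj
  · exact h _ (by rw [weight_flip_of_eq_zero hj]; omega)
  · rfl

theorem raise_mem_weightSpace {u : ℕ} {ψ : Qubits n} (h : ψ ∈ weightSpace n u) :
    raise n ψ ∈ weightSpace n (u + 1) := by
  intro w hw
  rw [raise_apply]
  refine sum_eq_zero fun j _ => ?_
  split_ifs with hj
  · exact h _ (by have := weight_flip_of_eq_one hj; omega)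
  · rfl

theorem raise_pow_mem_weightSpace {u : ℕ} {ψ : Qubits n} (h : ψ ∈ weightSpace n u) (j : ℕ) :
    (raise n ^ j) ψ ∈ weightSpace n (u + j) := by
  induction j with
  | zero => exact h
  | succ j ih =>
    rw [pow_succ', Module.End.mul_apply]
    exact raise_mem_weightSpace ih

/-- The commutator of `lower` and `raise` acts on vectors of weight `u` as `n - 2u`. -/
theorem lower_raise {u : ℕ} {ψ : Qubits n} (h : ψ ∈ weightSpace n u) :
    lower n (raise n ψ) = raise n (lower n ψ) + ((n : ℂ) - 2 * u) • ψ := by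
  ext w
  simp only [lower_apply, raise_apply, PiLp.add_apply, PiLp.smul_apply, smul_eq_mul]
  have hdiag : ∑ j, ((if w j = 0 then ψ w else 0) - (if w j = 1 then ψ w else 0)) =
      ((n : ℂ) - 2 * u) * ψ w := by
    by_cases hw : weight w = u
    · have h1 : ∑ j, (if w j = 1 then ψ w else 0) = (u : ℂ) * ψ w := by
        rw [← sum_filter, sum_const, nsmul_eq_mul, ← hw]
        rfl
      have h0 : ∀ j, (if w j = 0 then ψ w else 0) = ψ w - (if w j = 1 then ψ w else 0) := by
        intro j
        rcases (by omega : w j = 0 ∨ w j = 1) with hj | hj <;> simp [hj]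
      simp only [h0, sum_sub_distrib, h1]
      simp
      ring
    · simp [h w hw]
  rw [← hdiag, ← sub_eq_iff_eq_add']
  have e1 : ∀ i, (if w i = 0 then ∑ j, (if flip i w j = 1 then ψ (flip j (flip i w)) else 0)
      else 0) = ∑ j, if w i = 0 ∧ flip i w j = 1 then ψ (flip j (flip i w)) else 0 := by
    intro i
    split_ifs with hi <;> simp [hi]
  have e2 : ∀ i, (if w i = 1 then ∑ j, (if flip i w j = 0 then ψ (flip j (flip i w)) else 0)
      else 0) = ∑ j, if w i = 1 ∧ flip i w j = 0 then ψ (flip j (flip i w)) else 0 := by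
    intro i
    split_ifs with hi <;> simp [hi]
  simp only [e1, e2]
  -- After exchanging the indices in one of the double sums, the terms with `i ≠ j` cancel because
  -- the two flips commute; the diagonal terms give (number of zeros) - (number of ones).
  rw [sum_comm (f := fun i j => if w i = 1 ∧ flip i w j = 0 then ψ (flip j (flip i w)) else 0),
    ← sum_sub_distrib]
  refine sum_congr rfl fun i _ => ?_
  rw [← sum_sub_distrib, sum_eq_single i]
  · rcases (by omega : w i = 0 ∨ w i = 1) with hi | hi <;> simp [hi]
  · intro j _ hj
    rw [flip_of_ne hj, flip_of_ne hj.symm, flip_comm i j]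
    simp only [and_comm, sub_self]
  · simp

/-- The vectors of weight `u` annihilated by `lower`. -/
noncomputable def primitive (n u : ℕ) : Submodule ℂ (Qubits n) :=
  weightSpace n u ⊓ LinearMap.ker (lower n)

theorem lower_raise_pow_succ {u : ℕ} {v : Qubits n} (h : v ∈ primitive n u) (b : ℕ) :
    lower n ((raise n ^ (b + 1)) v) =
      (((b : ℂ) + 1) * ((n : ℂ) - 2 * u - b)) • (raise n ^ b) v := by
  induction b with
  | zero =>
    have h2 : lower n v = 0 := h.2
    simp [lower_raise h.1, h2]
  | succ b ih =>
    rw [pow_succ' _ (b + 1), Module.End.mul_apply,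
      lower_raise (raise_pow_mem_weightSpace h.1 (b + 1)), ih, map_smul,
      ← Module.End.mul_apply, ← pow_succ', ← add_smul]
    congr 1
    push_cast
    ring

/-- Iteration of `lower_raise_pow_succ`. The bound `hb` makes the truncated subtractions exact and
keeps the scalar nonzero, so `F^j` is injective on primitive vectors as long as `2u + j ≤ n`. -/
theorem lower_pow_raise_pow {u : ℕ} {v : Qubits n} (h : v ∈ primitive n u) (a b : ℕ)
    (hb : 2 * u + (b + a) ≤ n) :
    (lower n ^ a) ((raise n ^ (b + a)) v) =
      (((b + a).descFactorial a * (n - 2 * u - b).descFactorial a : ℕ) : ℂ) •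
        (raise n ^ b) v := by
  induction a generalizing b with
  | zero => simp
  | succ a ih =>
    have h1 := ih (b + 1) (by omega)
    rw [show b + (a + 1) = b + 1 + a by ring, pow_succ', Module.End.mul_apply, h1, map_smul,
      lower_raise_pow_succ h, smul_smul]
    congr 1
    rw [Nat.descFactorial_succ (b + 1 + a), show n - 2 * u - b = (n - 2 * u - (b + 1)) + 1 by omega,
      Nat.succ_descFactorial_succ, show b + 1 + a - a = b + 1 by omega]
    have : ((n - 2 * u - (b + 1) : ℕ) : ℂ) = (n : ℂ) - 2 * u - b - 1 := by
      rw [Nat.cast_sub (by omega), Nat.cast_sub (by omega)]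
      push_cast
      ring
    push_cast
    rw [this]
    ring

theorem lower_pow_raise_pow_of_lt {u : ℕ} {v : Qubits n} (h : v ∈ primitive n u) {a b : ℕ}
    (hab : b < a) : (lower n ^ a) ((raise n ^ b) v) = 0 := by
  induction b generalizing a with
  | zero =>
    obtain ⟨a, rfl⟩ : ∃ a', a = a' + 1 := ⟨a - 1, by omega⟩
    have h2 : lower n v = 0 := h.2
    rw [pow_zero, Module.End.one_apply, pow_succ, Module.End.mul_apply, h2, map_zero]
  | succ b ih =>
    obtain ⟨a, rfl⟩ : ∃ a', a = a' + 1 := ⟨a - 1, by omega⟩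
    rw [pow_succ, Module.End.mul_apply, lower_raise_pow_succ h, map_smul, ih (by omega), smul_zero]

/-- `F^(m-u) v` is an eigenvector of `F^(m-r) E^(m-r)` for `v` primitive of weight `u`. -/
theorem raise_pow_lower_pow_raise_pow {u m r : ℕ} {v : Qubits n} (h : v ∈ primitive n u)
    (hu : u ≤ m) (hr : r ≤ m) (hm : m + m ≤ n) :
    (raise n ^ (m - r)) ((lower n ^ (m - r)) ((raise n ^ (m - u)) v)) =
      (((m - u).descFactorial (m - r) * (n - u - r).descFactorial (m - r) : ℕ) : ℂ) •
        (raise n ^ (m - u)) v := by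
  rcases le_or_gt u r with hur | hur
  · have h1 := lower_pow_raise_pow h (m - r) (r - u) (by omega)
    rw [show r - u + (m - r) = m - u by omega, show n - 2 * u - (r - u) = n - u - r by omega] at h1
    rw [h1, map_smul, ← Module.End.mul_apply, ← pow_add, show m - r + (r - u) = m - u by omega]
  -- For `r < u` there are more lowerings than raisings, so the vector is killed; the falling
  -- factorial on the right vanishes as well.
  · rw [lower_pow_raise_pow_of_lt h (by omega),
      Nat.descFactorial_eq_zero_iff_lt.mpr (by omega : m - u < m - r)]
    simp

/-- The component of weight `u` of a vector. -/
noncomputable def weightPart (n u : ℕ) : Qubits n →ₗ[ℂ] Qubits n where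
  toFun ψ := WithLp.toLp 2 fun w => if weight w = u then ψ w else 0
  map_add' ψ φ := by
    ext w
    by_cases h : weight w = u <;> simp [h]
  map_smul' c ψ := by
    ext w
    by_cases h : weight w = u <;> simp [h]

theorem weightPart_apply (u : ℕ) (ψ : Qubits n) (w : Fin n → Fin 2) :
    weightPart n u ψ w = if weight w = u then ψ w else 0 := rfl

theorem weightPart_mem (u : ℕ) (ψ : Qubits n) : weightPart n u ψ ∈ weightSpace n u := by
  intro w hw
  simp [weightPart_apply, hw]

theorem weightPart_eq_self {u : ℕ} {ψ : Qubits n} (h : ψ ∈ weightSpace n u) :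
    weightPart n u ψ = ψ := by
  ext w
  rw [weightPart_apply]
  split_ifs with hw
  · rfl
  · rw [h w hw]

theorem weightPart_raise (u : ℕ) (ψ : Qubits n) :
    weightPart n (u + 1) (raise n ψ) = raise n (weightPart n u ψ) := by
  ext w
  simp only [weightPart_apply, raise_apply]
  have key : ∀ j, (if w j = 1 then if weight (flip j w) = u then ψ (flip j w) else 0 else 0) =
      if weight w = u + 1 then if w j = 1 then ψ (flip j w) else 0 else 0 := by
    intro j
    by_cases hj : w j = 1
    · have := weight_flip_of_eq_one hj
      simp [hj, ← this]
    · simp [hj]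
  simp only [key]
  split_ifs <;> simp

theorem lower_weightPart (u : ℕ) (ψ : Qubits n) :
    lower n (weightPart n (u + 1) ψ) = weightPart n u (lower n ψ) := by
  ext w
  simp only [weightPart_apply, lower_apply]
  have key : ∀ j, (if w j = 0 then if weight (flip j w) = u + 1 then ψ (flip j w) else 0
      else 0) = if weight w = u then if w j = 0 then ψ (flip j w) else 0 else 0 := by
    intro j
    by_cases hj : w j = 0
    · have := weight_flip_of_eq_zero hj
      simp [hj, this]
    · simp [hj]
  simp only [key]
  split_ifs <;> simp

/-- Project orthogonally onto the range of `F`. The remainder `v` satisfies `⟨Ev, Ev⟩ = ⟨FEv, v⟩ =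
0` by adjointness. -/
theorem exists_eq_raise_add (ψ : Qubits n) :
    ∃ φ v, lower n v = 0 ∧ ψ = raise n φ + v := by
  let R := LinearMap.range (raise n)
  obtain ⟨φ, hφ⟩ : R.starProjection ψ ∈ R := Submodule.starProjection_apply_mem R ψ
  refine ⟨φ, ψ - R.starProjection ψ, ?_, by rw [hφ]; abel⟩
  have h := Submodule.sub_starProjection_mem_orthogonal (K := R) ψ
  rw [Submodule.mem_orthogonal] at h
  rw [← inner_self_eq_zero (𝕜 := ℂ), ← inner_raise_left]
  exact h _ (LinearMap.mem_range_self _ _)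

/-- A vector of weight `m` is a sum of vectors raised from primitive ones. -/
theorem exists_sum_raise_pow {m : ℕ} {ψ : Qubits n} (h : ψ ∈ weightSpace n m) :
    ∃ v : ℕ → Qubits n, (∀ u, v u ∈ primitive n u) ∧
      ψ = ∑ u ∈ range (m + 1), (raise n ^ (m - u)) (v u) := by
  induction m generalizing ψ with
  | zero =>
    refine ⟨fun u => if u = 0 then ψ else 0, fun u => ?_, by simp⟩
    by_cases hu : u = 0
    · subst hu
      simp only [if_true]
      exact ⟨h, lower_eq_zero_of_mem_weightSpace_zero h⟩
    · simp [hu]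
  | succ m ih =>
    obtain ⟨φ, v, hv, hψ⟩ := exists_eq_raise_add ψ
    obtain ⟨v', hv', hφ⟩ := ih (weightPart_mem m φ)
    refine ⟨fun u => if u = m + 1 then weightPart n (m + 1) v else v' u, fun u => ?_, ?_⟩
    · dsimp only
      split_ifs with hu
      · subst hu
        refine ⟨weightPart_mem _ _, ?_⟩
        change lower n _ = 0
        rw [lower_weightPart, hv, map_zero]
      · exact hv' u
    -- Taking the part of weight `m + 1` of `ψ = Fφ + v` replaces `φ` by its part of weight `m`, to
    -- which the induction hypothesis applies, and `v` by a primitive vector.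
    · rw [sum_range_succ, ← weightPart_eq_self h, hψ, map_add, weightPart_raise, hφ, map_sum]
      simp only [Nat.sub_self, pow_zero, if_true, Module.End.one_apply]
      congr 1
      refine sum_congr rfl fun u hu => ?_
      have hu := mem_range.mp hu
      rw [if_neg (by omega), ← Module.End.mul_apply, ← pow_succ', Nat.sub_add_comm (by omega)]

end

/-! ### Specht modules as spaces of primitive vectors. -/

section

variable {n : ℕ}

/-- The vector `ψ` is antisymmetric under each of the transpositions `(a i  b i)`. -/
def AntisymmOn {x : ℕ} (a b : Fin x → Fin n) (s : Finset (Fin x)) (ψ : Qubits n) : Prop :=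
  ∀ i ∈ s, permRep n (Equiv.swap (a i) (b i)) ψ = -ψ

theorem apply_comp_swap {p q : Fin n} {ψ : Qubits n}
    (h : permRep n (Equiv.swap p q) ψ = -ψ) (w : Fin n → Fin 2) :
    ψ (w ∘ Equiv.swap p q) = -ψ w := by
  rw [← permRep_apply, h]
  rfl

theorem comp_swap_eq_self {p q : Fin n} {w : Fin n → Fin 2} (hw : w p = w q) :
    w ∘ Equiv.swap p q = w := by
  funext i
  rw [Function.comp_apply, Equiv.swap_apply_def]
  split_ifs with h1 h2
  · rw [h1, hw]
  · rw [h2, hw]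
  · rfl

theorem apply_eq_zero_of_antisymm {p q : Fin n} {ψ : Qubits n}
    (h : permRep n (Equiv.swap p q) ψ = -ψ) {w : Fin n → Fin 2} (hw : w p = w q) : ψ w = 0 := by
  have := apply_comp_swap h w
  rw [comp_swap_eq_self hw] at this
  exact CharZero.eq_neg_self_iff.mp this

/-- In column `i`, the entry `a i` for `i ∈ s` and `b i` for `i ∉ s`. -/
def columnEntry {x : ℕ} (a b : Fin x → Fin n) (s : Finset (Fin x)) (i : Fin x) : Fin n :=
  if i ∈ s then a i else b i

theorem columnEntry_injective {x : ℕ} {a b : Fin x → Fin n}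
    (hab : Function.Injective (Sum.elim a b)) (s : Finset (Fin x)) :
    Function.Injective (columnEntry a b s) := by
  obtain ⟨ha, hb, hne⟩ := Sum.elim_injective.mp hab
  intro i j hij
  unfold columnEntry at hij
  split_ifs at hij with h1 h2 h2
  · exact ha hij
  · exact absurd hij (hne _ _)
  · exact absurd hij.symm (hne _ _)
  · exact hb hij

theorem columnWord_eq_one_iff {x : ℕ} {a b : Fin x → Fin n} {s : Finset (Fin x)} {j : Fin n} :
    columnWord a b s j = 1 ↔ ∃ i, columnEntry a b s i = j := by
  classical
  have : columnWord a b s j =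
      if (∃ i ∈ s, a i = j) ∨ (∃ i, i ∉ s ∧ b i = j) then 1 else 0 := by
    unfold columnWord
    congr
  rw [this, ite_eq_left_iff]
  simp only [zero_ne_one, imp_false, not_not, columnEntry]
  constructor
  · rintro (⟨i, hi, rfl⟩ | ⟨i, hi, rfl⟩) <;> exact ⟨i, by simp [hi]⟩
  · rintro ⟨i, hi⟩
    by_cases his : i ∈ s
    · exact Or.inl ⟨i, his, by simpa [his] using hi⟩
    · exact Or.inr ⟨i, his, by simpa [his] using hi⟩

theorem word_ext {w v : Fin n → Fin 2} (h : ∀ j, w j = 1 ↔ v j = 1) : w = v := by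
  funext j
  have := h j
  omega

theorem weight_columnWord {x : ℕ} {a b : Fin x → Fin n}
    (hab : Function.Injective (Sum.elim a b)) (s : Finset (Fin x)) :
    weight (columnWord a b s) = x := by
  have : (univ.filter fun j => columnWord a b s j = 1) = univ.image (columnEntry a b s) := by
    ext j
    simp [columnWord_eq_one_iff]
  rw [weight, this, card_image_of_injective _ (columnEntry_injective hab s)]
  simp

theorem polytabloid_mem_weightSpace {x : ℕ} {a b : Fin x → Fin n}
    (hab : Function.Injective (Sum.elim a b)) : polytabloid a b ∈ weightSpace n x := by
  refine Submodule.sum_mem _ fun s _ => Submodule.smul_mem _ _ ?_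
  have := ket_mem_weightSpace (columnWord a b s)
  rwa [weight_columnWord hab] at this

theorem apply_ne_apply {x : ℕ} {a b : Fin x → Fin n} {ψ : Qubits n}
    (h : AntisymmOn a b univ ψ) {w : Fin n → Fin 2} (hw : ψ w ≠ 0) (i : Fin x) :
    w (a i) ≠ w (b i) := fun h' => hw (apply_eq_zero_of_antisymm (h i (mem_univ i)) h')

/-- A word in the support of a vector antisymmetric in `x` columns has letter `1` at one entry of
each of these columns. -/
theorem columnWord_le {x : ℕ} {a b : Fin x → Fin n} {ψ : Qubits n}
    (h : AntisymmOn a b univ ψ) {w : Fin n → Fin 2} (hw : ψ w ≠ 0) (i : Fin x) :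
    w (columnEntry a b (univ.filter fun i => w (a i) = 1) i) = 1 := by
  have := apply_ne_apply h hw i
  unfold columnEntry
  split_ifs with hi
  · simpa using hi
  · simp only [mem_filter, mem_univ, true_and] at hi
    omega

theorem le_weight_of_antisymmOn {x : ℕ} {a b : Fin x → Fin n}
    (hab : Function.Injective (Sum.elim a b)) {ψ : Qubits n} (h : AntisymmOn a b univ ψ)
    {w : Fin n → Fin 2} (hw : ψ w ≠ 0) : x ≤ weight w := by
  rw [← weight_columnWord hab (univ.filter fun i => w (a i) = 1)]
  refine card_le_card fun j hj => ?_
  simp only [mem_filter, mem_univ, true_and, columnWord_eq_one_iff] at hj ⊢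
  obtain ⟨i, rfl⟩ := hj
  exact columnWord_le h hw i

/-- The equality case of `le_weight_of_antisymmOn`: with one letter 1 in each column, none is left
for the other positions. -/
theorem eq_columnWord_of_antisymmOn {x : ℕ} {a b : Fin x → Fin n}
    (hab : Function.Injective (Sum.elim a b)) {ψ : Qubits n} (h : AntisymmOn a b univ ψ)
    {w : Fin n → Fin 2} (hw : ψ w ≠ 0) (hx : weight w = x) :
    w = columnWord a b (univ.filter fun i => w (a i) = 1) := by
  set s := univ.filter fun i => w (a i) = 1
  have hsub : (univ.filter fun j => columnWord a b s j = 1) ⊆ univ.filter fun j => w j = 1 := by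
    intro j hj
    simp only [mem_filter, mem_univ, true_and, columnWord_eq_one_iff] at hj ⊢
    obtain ⟨i, rfl⟩ := hj
    exact columnWord_le h hw i
  have heq := eq_of_subset_of_card_le hsub
    (by change weight w ≤ weight (columnWord a b s); rw [hx, weight_columnWord hab])
  refine word_ext fun j => ?_
  simpa using (Finset.ext_iff.mp heq j).symm

theorem eq_zero_of_antisymmOn {x u : ℕ} {a b : Fin x → Fin n}
    (hab : Function.Injective (Sum.elim a b)) {ψ : Qubits n} (h : AntisymmOn a b univ ψ)
    (hψ : ψ ∈ weightSpace n u) (hu : u < x) : ψ = 0 := by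
  ext w
  by_contra hw
  have h1 := le_weight_of_antisymmOn hab h hw
  exact hw (hψ w (by omega))

theorem AntisymmOn.lower_pow {x : ℕ} {a b : Fin x → Fin n} {s : Finset (Fin x)} {ψ : Qubits n}
    (h : AntisymmOn a b s ψ) (j : ℕ) : AntisymmOn a b s ((lower n ^ j) ψ) := fun i hi => by
  rw [← lower_pow_permRep, h i hi, map_neg]

theorem AntisymmOn.raise_pow {x : ℕ} {a b : Fin x → Fin n} {s : Finset (Fin x)} {ψ : Qubits n}
    (h : AntisymmOn a b s ψ) (j : ℕ) : AntisymmOn a b s ((raise n ^ j) ψ) := fun i hi => by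
  rw [← raise_pow_permRep, h i hi, map_neg]

theorem swap_columnEntry {x : ℕ} {a b : Fin x → Fin n}
    (hab : Function.Injective (Sum.elim a b)) (s : Finset (Fin x)) (i k : Fin x) :
    Equiv.swap (a i) (b i) (columnEntry a b s k) = columnEntry a b (symmDiff s {i}) k := by
  obtain ⟨ha, hb, hne⟩ := Sum.elim_injective.mp hab
  by_cases hki : k = i
  · subst hki
    by_cases hk : k ∈ s <;> simp [columnEntry, mem_symmDiff, hk]
  · have h1 : columnEntry a b (symmDiff s {i}) k = columnEntry a b s k := by
      simp [columnEntry, mem_symmDiff, hki]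
    rw [h1]
    refine Equiv.swap_apply_of_ne_of_ne ?_ ?_ <;> unfold columnEntry <;> split_ifs
    · exact fun h => hki (ha h)
    · exact fun h => hne _ _ h.symm
    · exact fun h => hne _ _ h
    · exact fun h => hki (hb h)

theorem columnWord_comp_swap {x : ℕ} {a b : Fin x → Fin n}
    (hab : Function.Injective (Sum.elim a b)) (s : Finset (Fin x)) (i : Fin x) :
    columnWord a b s ∘ Equiv.swap (a i) (b i) = columnWord a b (symmDiff s {i}) := by
  refine word_ext fun j => ?_
  rw [Function.comp_apply, columnWord_eq_one_iff, columnWord_eq_one_iff]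
  refine exists_congr fun k => ?_
  rw [← swap_columnEntry hab, Equiv.swap_apply_eq_iff]

theorem neg_one_pow_card_symmDiff_singleton {x : ℕ} (s : Finset (Fin x)) (i : Fin x) :
    (-1 : ℂ) ^ (symmDiff s {i}).card = -(-1) ^ s.card := by
  by_cases hi : i ∈ s
  · have : s = insert i (symmDiff s {i}) := by
      ext k
      by_cases hk : k = i <;> simp [mem_symmDiff, hk, hi]
    conv_rhs => rw [this]
    rw [card_insert_of_notMem (by simp [mem_symmDiff, hi]), pow_succ]
    ring
  · have : symmDiff s {i} = insert i s := by
      ext k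
      by_cases hk : k = i <;> simp [mem_symmDiff, hk, hi]
    rw [this, card_insert_of_notMem hi, pow_succ]
    ring

theorem polytabloid_antisymmOn {x : ℕ} {a b : Fin x → Fin n}
    (hab : Function.Injective (Sum.elim a b)) : AntisymmOn a b univ (polytabloid a b) := by
  intro i _
  simp only [polytabloid, map_sum, map_smul, permRep_ket, Equiv.swap_inv, ← sum_neg_distrib]
  refine sum_nbij' (fun s => symmDiff s {i}) (fun s => symmDiff s {i}) (by simp) (by simp)
    (by simp) (by simp) fun s _ => ?_
  rw [neg_one_pow_card_symmDiff_singleton, ← columnWord_comp_swap hab, neg_smul, neg_neg]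
  rfl

/-- `E` preserves antisymmetry, so the image of a polytabloid is antisymmetric in `x` columns but
has weight `x - 1`, too small for a nonzero vector. -/
theorem specht_le_primitive (n x : ℕ) : (specht n x).toSubmodule ≤ primitive n x := by
  refine Submodule.span_le.mpr ?_
  rintro _ ⟨a, b, hab, rfl⟩
  refine ⟨polytabloid_mem_weightSpace hab, ?_⟩
  change lower n (polytabloid a b) = 0
  rcases x with _ | x
  · exact lower_eq_zero_of_mem_weightSpace_zero (polytabloid_mem_weightSpace hab)
  · have := (polytabloid_antisymmOn hab).lower_pow 1
    rw [pow_one] at this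
    exact eq_zero_of_antisymmOn hab this (lower_mem_weightSpace (polytabloid_mem_weightSpace hab))
      (Nat.lt_succ_self x)

theorem AntisymmOn.apply_columnWord {x : ℕ} {a b : Fin x → Fin n}
    (hab : Function.Injective (Sum.elim a b)) {ψ : Qubits n} (h : AntisymmOn a b univ ψ)
    (s : Finset (Fin x)) :
    ψ (columnWord a b s) = (-1) ^ s.card * ψ (columnWord a b ∅) := by
  induction s using Finset.induction_on with
  | empty => simp
  | insert i s hi ih =>
    have : insert i s = symmDiff s {i} := by
      ext k
      by_cases hk : k = i <;> simp [mem_symmDiff, hk, hi]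
    rw [this, ← columnWord_comp_swap hab, apply_comp_swap (h i (mem_univ i)), ih,
      columnWord_comp_swap hab, neg_one_pow_card_symmDiff_singleton]
    ring

theorem inner_ket (w : Fin n → Fin 2) (ψ : Qubits n) : inner ℂ (ket w) ψ = ψ w := by
  simp [ket, EuclideanSpace.inner_single_left]

/-- Such a vector is determined by its value at a single column word, hence is a multiple of the
polytabloid; the inner product is `2^x` times that value. -/
theorem eq_zero_of_inner_polytabloid {x : ℕ} {a b : Fin x → Fin n}
    (hab : Function.Injective (Sum.elim a b)) {ψ : Qubits n} (h : AntisymmOn a b univ ψ)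
    (hψ : ψ ∈ weightSpace n x) (h0 : inner ℂ (polytabloid a b) ψ = 0) : ψ = 0 := by
  have h1 : inner ℂ (polytabloid a b) ψ = 2 ^ x * ψ (columnWord a b ∅) := by
    simp only [polytabloid, sum_inner, inner_smul_left, inner_ket]
    have : ∀ s : Finset (Fin x), starRingEnd ℂ ((-1) ^ s.card) * ψ (columnWord a b s) =
        ψ (columnWord a b ∅) := fun s => by
      rw [h.apply_columnWord hab s, map_pow, map_neg, map_one, ← mul_assoc, ← mul_pow]
      simp
    rw [sum_congr rfl fun s _ => this s, sum_const, nsmul_eq_mul, card_univ, Fintype.card_finset,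
      Fintype.card_fin]
    push_cast
    rfl
  rw [h1] at h0
  have h2 : ψ (columnWord a b ∅) = 0 := by simpa using h0
  ext w
  by_contra hw
  have hwt : weight w = x := by
    by_contra hne
    exact hw (hψ w hne)
  have h3 := eq_columnWord_of_antisymmOn hab h hw hwt
  apply hw
  rw [h3, h.apply_columnWord hab, h2, mul_zero]
  rfl

theorem flip_flip_eq_comp_swap {w : Fin n → Fin 2} {i j : Fin n} (hij : i ≠ j) (hj : w j = 1)
    (hi : w i = 0) : flip i (flip j w) = w ∘ Equiv.swap i j := by
  funext k
  rw [Function.comp_apply, Equiv.swap_apply_def]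
  split_ifs with h1 h2
  · subst h1
    rw [flip_same, flip_of_ne hij, hi, hj]
    rfl
  · subst h2
    rw [flip_of_ne h1, flip_same, hi, hj]
    rfl
  · rw [flip_of_ne h1, flip_of_ne h2]

theorem swap_comm_of_disjoint {p q p' q' : Fin n} (h1 : p ≠ p') (h2 : p ≠ q') (h3 : q ≠ p')
    (h4 : q ≠ q') : Commute (Equiv.swap p q) (Equiv.swap p' q') := by
  refine Equiv.Perm.Disjoint.commute fun k => ?_
  by_cases hk : k = p ∨ k = q
  · right
    rcases hk with rfl | rfl
    · exact Equiv.swap_apply_of_ne_of_ne h1 h2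
    · exact Equiv.swap_apply_of_ne_of_ne h3 h4
  · left
    push Not at hk
    exact Equiv.swap_apply_of_ne_of_ne hk.1 hk.2

theorem permRep_comm {g g' : Equiv.Perm (Fin n)} (h : Commute g g') (ψ : Qubits n) :
    permRep n g (permRep n g' ψ) = permRep n g' (permRep n g ψ) := by
  rw [← Module.End.mul_apply, ← Module.End.mul_apply, ← map_mul, ← map_mul, h.eq]

theorem permRep_swap_swap (p q : Fin n) (ψ : Qubits n) :
    permRep n (Equiv.swap p q) (permRep n (Equiv.swap p q) ψ) = ψ := by
  rw [← Module.End.mul_apply, ← map_mul, Equiv.swap_mul_self, map_one, Module.End.one_apply]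

theorem permRep_mem_primitive {u : ℕ} (g : Equiv.Perm (Fin n)) {ψ : Qubits n}
    (h : ψ ∈ primitive n u) : permRep n g ψ ∈ primitive n u := by
  refine ⟨permRep_mem_weightSpace g h.1, ?_⟩
  have h2 : lower n ψ = 0 := h.2
  change lower n _ = 0
  rw [lower_permRep, h2, map_zero]

theorem permRep_mem_orthogonal {u : ℕ} (g : Equiv.Perm (Fin n)) {ψ : Qubits n}
    (h : ψ ∈ (specht n u).toSubmoduleᗮ) : permRep n g ψ ∈ (specht n u).toSubmoduleᗮ := by
  rw [Submodule.mem_orthogonal] at h ⊢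
  intro φ hφ
  rw [← inner_permRep g⁻¹, ← Module.End.mul_apply, ← map_mul, inv_mul_cancel, map_one]
  exact h _ ((specht n u).apply_mem_toSubmodule _ hφ)

/-- If a primitive vector, antisymmetric in `r` columns, is symmetric in all other positions and
its weight exceeds `r`, then it vanishes. -/
theorem eq_zero_of_antisymmOn_of_symm {u r : ℕ} (hr : r < u) {a b : Fin r → Fin n}
    {ψ : Qubits n} (hψ : ψ ∈ primitive n u) (h : AntisymmOn a b univ ψ)
    (hs : ∀ p q, p ≠ q → (∀ i, p ≠ a i ∧ p ≠ b i) → (∀ i, q ≠ a i ∧ q ≠ b i) →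
      permRep n (Equiv.swap p q) ψ = ψ) : ψ = 0 := by
  ext w
  by_contra hw
  have hwt : weight w = u := by
    by_contra hne
    exact hw (hψ.1 w hne)
  -- Each of the `r` columns contains exactly one letter 1 of `w`, and `u > r`, so some letter 1
  -- lies outside the columns.
  obtain ⟨j, hj, hjo⟩ : ∃ j, w j = 1 ∧ ∀ i, j ≠ a i ∧ j ≠ b i := by
    by_contra! hcon
    have hsub : (univ.filter fun j => w j = 1) ⊆
        univ.image (columnEntry a b (univ.filter fun i => w (a i) = 1)) := by
      intro j hj
      simp only [mem_filter, mem_univ, true_and] at hj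
      obtain ⟨i, hi⟩ := hcon j hj
      have hne := apply_ne_apply h hw i
      refine mem_image.mpr ⟨i, mem_univ i, ?_⟩
      by_cases hja : j = a i
      · subst hja
        simp [columnEntry, hj]
      · have hjb := hi hja
        subst hjb
        rw [hj] at hne
        simp [columnEntry, hne]
    have h1 := (card_le_card hsub).trans card_image_le
    rw [card_univ, Fintype.card_fin] at h1
    change weight w ≤ r at h1
    omega
  have hE : lower n ψ (flip j w) = 0 := by
    have h2 : lower n ψ = 0 := hψ.2
    rw [h2]
    rfl
  rw [lower_apply] at hE
  -- In `Eψ` evaluated at `flip j w`, a new letter 1 inside a column makes both entries of that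
  -- column equal, so the term vanishes by antisymmetry. A new letter 1 outside the columns gives `ψ
  -- w` by symmetry. Thus `0` is `ψ w` times a count that is positive because it includes `j`.
  have hterm : ∀ i, (if flip j w i = 0 then ψ (flip i (flip j w)) else 0) =
      if flip j w i = 0 ∧ ∀ k, i ≠ a k ∧ i ≠ b k then ψ w else 0 := by
    intro i
    by_cases hi : flip j w i = 0
    · by_cases ho : ∀ k, i ≠ a k ∧ i ≠ b k
      · rw [if_pos hi, if_pos ⟨hi, ho⟩]
        by_cases hij : i = j
        · rw [hij, flip_flip]
        · rw [flip_of_ne hij] at hi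
          rw [flip_flip_eq_comp_swap hij hj hi, ← permRep_apply, hs i j hij ho hjo]
      · rw [if_pos hi, if_neg (fun h' => ho h'.2)]
        push Not at ho
        obtain ⟨k, hk⟩ := ho
        have hne := apply_ne_apply h hw k
        refine apply_eq_zero_of_antisymm (h k (mem_univ k)) ?_
        have hja := (hjo k).1
        have hjb := (hjo k).2
        by_cases hia : i = a k
        · have hab : b k ≠ a k := fun h' => hne (by rw [h'])
          rw [hia, flip_of_ne hja.symm] at hi
          rw [hia, flip_same, flip_of_ne hab, flip_of_ne hja.symm, flip_of_ne hjb.symm, hi]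
          rw [hi] at hne
          omega
        · have hib := hk hia
          have hab : a k ≠ b k := fun h' => hne (by rw [h'])
          rw [hib, flip_of_ne hjb.symm] at hi
          rw [hib, flip_same, flip_of_ne hab, flip_of_ne hja.symm, flip_of_ne hjb.symm, hi]
          rw [hi] at hne
          omega
    · rw [if_neg hi, if_neg (fun h' => hi h'.1)]
  simp only [hterm, ← sum_filter, sum_const, nsmul_eq_mul, mul_eq_zero, Nat.cast_eq_zero,
    card_eq_zero] at hE
  rcases hE with hE | hE
  · have : j ∈ (∅ : Finset (Fin n)) := by
      rw [← hE]
      simp [hj, hjo]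
    simp at this
  · exact hw hE

/-- Downward induction on `r`. For `r = u` the vector is a multiple of a polytabloid to which it is
orthogonal. For `r < u` and `p`, `q` outside the columns, `ψ - (p q)ψ` is antisymmetric in the
additional column `(p, q)`, hence zero by induction; so `ψ` is symmetric outside the columns and
`eq_zero_of_antisymmOn_of_symm` applies. -/
theorem primitive_eq_zero_of_antisymmOn {u r : ℕ} (hr : r ≤ u) {a b : Fin r → Fin n}
    (hab : Function.Injective (Sum.elim a b)) {ψ : Qubits n} (hψ : ψ ∈ primitive n u)
    (ho : ψ ∈ (specht n u).toSubmoduleᗮ) (h : AntisymmOn a b univ ψ) : ψ = 0 := by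
  obtain ⟨d, hd⟩ := Nat.exists_eq_add_of_le hr
  induction d generalizing r ψ with
  | zero =>
    obtain rfl : u = r := by omega
    exact eq_zero_of_inner_polytabloid hab h hψ.1
      ((Submodule.mem_orthogonal _ _).mp ho _ (Submodule.subset_span ⟨a, b, hab, rfl⟩))
  | succ d ih =>
    refine eq_zero_of_antisymmOn_of_symm (by omega) hψ h fun p q hpq hp hq => ?_
    obtain ⟨ha, hb, hne⟩ := Sum.elim_injective.mp hab
    refine (sub_eq_zero.mp (ih (r := r + 1) (by omega) (a := Fin.cons p a) (b := Fin.cons q b)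
      ?_ (Submodule.sub_mem _ hψ (permRep_mem_primitive (Equiv.swap p q) hψ))
      (Submodule.sub_mem _ ho (permRep_mem_orthogonal (Equiv.swap p q) ho)) ?_ (by omega))).symm
    · refine Function.Injective.sumElim (Fin.cons_injective_iff.mpr ⟨?_, ha⟩)
        (Fin.cons_injective_iff.mpr ⟨?_, hb⟩) fun i j => ?_
      · rintro ⟨i, hi⟩
        exact (hp i).1 hi.symm
      · rintro ⟨i, hi⟩
        exact (hq i).2 hi.symm
      · refine Fin.cases ?_ (fun i => ?_) i <;> refine Fin.cases ?_ (fun j => ?_) j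
        · simpa using hpq
        · simpa using (hp j).2
        · simpa using (hq i).1.symm
        · simpa using hne i j
    · intro i _
      refine Fin.cases ?_ (fun i => ?_) i
      · simp only [Fin.cons_zero, map_sub, permRep_swap_swap]
        abel
      · simp only [Fin.cons_succ, map_sub]
        rw [permRep_comm (swap_comm_of_disjoint (hp i).1.symm (hq i).1.symm (hp i).2.symm
          (hq i).2.symm), h i (mem_univ i), map_neg]
        abel

/-- The Specht module consists of the vectors of weight `u` annihilated by `lower`. -/
theorem specht_eq_primitive (n u : ℕ) : (specht n u).toSubmodule = primitive n u := by
  refine le_antisymm (specht_le_primitive n u) fun ψ hψ => ?_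
  set S := (specht n u).toSubmodule
  have h1 : ψ - S.starProjection ψ ∈ Sᗮ := Submodule.sub_starProjection_mem_orthogonal ψ
  have h2 : S.starProjection ψ ∈ S := Submodule.starProjection_apply_mem S ψ
  have h3 : ψ - S.starProjection ψ = 0 :=
    -- With no columns the antisymmetry condition is empty, so only primitivity and orthogonality to
    -- the Specht module are needed.
    primitive_eq_zero_of_antisymmOn (r := 0) (Nat.zero_le u) (a := Fin.elim0) (b := Fin.elim0)
      (Function.injective_of_subsingleton _) (Submodule.sub_mem _ hψ (specht_le_primitive n u h2))
      h1 fun i => i.elim0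
  rw [sub_eq_zero.mp h3]
  exact h2

end

/-! ### Isotypic components and their projectors. -/

section

variable {n : ℕ}

theorem single_smul_asModule (c : ℂ) (g : Equiv.Perm (Fin n)) (v : Qubits n) :
    (MonoidAlgebra.single g c • (show (permRep n).asModule from v)) = c • permRep n g v :=
  Representation.single_smul (permRep n) c g v

/-- `Φ` commutes with the action of the symmetric group. -/
def IsEquivariant {x : ℕ} (Φ : (specht n x).toSubmodule →ₗ[ℂ] Qubits n) : Prop :=
  ∀ (g : Equiv.Perm (Fin n)) (z z' : (specht n x).toSubmodule),
    (z' : Qubits n) = permRep n g z → Φ z' = permRep n g (Φ z)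

/-- The isotypic component is spanned by the images of the Specht module under equivariant maps. -/
theorem isotypic_induction {x : ℕ} {motive : Qubits n → Prop} {v : Qubits n}
    (hv : v ∈ isotypic n x)
    (mem : ∀ Φ : (specht n x).toSubmodule →ₗ[ℂ] Qubits n, IsEquivariant Φ → ∀ z, motive (Φ z))
    (zero : motive 0) (add : ∀ v w, motive v → motive w → motive (v + w)) : motive v := by
  have hv' : (v : (permRep n).asModule) ∈ isotypicComponent (MonoidAlgebra ℂ (Equiv.Perm (Fin n)))
    (permRep n).asModule (specht n x).asSubmodule := hv
  rw [isotypicComponent, sSup_eq_iSup'] at hv'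
  refine Submodule.iSup_induction _ (motive := fun w : (permRep n).asModule => motive w) hv'
    ?_ zero add
  rintro ⟨N, ⟨e⟩⟩ w hw
  let f : (specht n x).asSubmodule →ₗ[MonoidAlgebra ℂ (Equiv.Perm (Fin n))] (permRep n).asModule :=
    N.subtype ∘ₗ e.symm.toLinearMap
  -- Linearity over the group algebra, tested on the elements `c · g`: `g = 1` gives complex
  -- linearity and `c = 1` gives equivariance.
  have key : ∀ (c : ℂ) (g : Equiv.Perm (Fin n)) (z z' : (specht n x).asSubmodule),
      (z'.1 : Qubits n) = c • permRep n g z.1 → (f z' : Qubits n) = c • permRep n g (f z) := by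
    intro c g z z' h
    have hz : z' = MonoidAlgebra.single g c • z := by
      apply Subtype.ext
      rw [Submodule.coe_smul]
      exact h.trans (single_smul_asModule c g z.1).symm
    rw [hz, map_smul]
    exact single_smul_asModule c g _
  let Φ : (specht n x).toSubmodule →ₗ[ℂ] Qubits n :=
    { toFun := fun z => f ⟨z.1, z.2⟩
      map_add' := fun y z => f.map_add ⟨y.1, y.2⟩ ⟨z.1, z.2⟩
      map_smul' := fun c z => by
        have := key c 1 ⟨z.1, z.2⟩ ⟨(c • z).1, (c • z).2⟩ (by rw [map_one]; rfl)
        rw [map_one] at this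
        exact this }
  have hΦ := mem Φ (fun g z z' h => by
    have := key 1 g ⟨z.1, z.2⟩ ⟨z'.1, z'.2⟩ (h.trans (one_smul ℂ (permRep n g z.1)).symm)
    rw [one_smul] at this
    exact this) ⟨(e ⟨w, hw⟩).1, (e ⟨w, hw⟩).2⟩
  have hw' : f (e ⟨w, hw⟩) = w := by simp [f]
  have : Φ ⟨(e ⟨w, hw⟩).1, (e ⟨w, hw⟩).2⟩ = w := hw'
  rwa [this] at hΦ

/-- The image of the Specht module under an injective equivariant endomorphism lies in the
isotypic component. -/
theorem apply_mem_isotypic {x : ℕ} (T : Qubits n →ₗ[ℂ] Qubits n)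
    (hT : ∀ g v, T (permRep n g v) = permRep n g (T v))
    (hinj : ∀ v ∈ (specht n x).toSubmodule, T v = 0 → v = 0) {v : Qubits n}
    (hv : v ∈ (specht n x).toSubmodule) : T v ∈ isotypic n x := by
  let T' : (permRep n).asModule →ₗ[MonoidAlgebra ℂ (Equiv.Perm (Fin n))] (permRep n).asModule :=
    Representation.IntertwiningMap.equivLinearMapAsModule (permRep n) (permRep n)
      (T.intertwiningMap_of_isIntertwiningMap _ _ hT)
  let f := T' ∘ₗ (specht n x).asSubmodule.subtype
  have hf : Function.Injective f := by
    rw [← LinearMap.ker_eq_bot, LinearMap.ker_eq_bot']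
    intro z hz
    exact Subtype.ext (hinj z.1 z.2 hz)
  have hle : LinearMap.range f ≤ isotypicComponent (MonoidAlgebra ℂ (Equiv.Perm (Fin n)))
      (permRep n).asModule (specht n x).asSubmodule :=
    le_sSup ⟨(LinearEquiv.ofInjective f hf).symm⟩
  exact hle ⟨⟨v, hv⟩, rfl⟩

/-- `F^j` is equivariant, and injective on the Specht module because `E^j F^j` acts there as a
nonzero scalar. -/
theorem raise_pow_mem_isotypic {u j : ℕ} (hj : 2 * u + j ≤ n) {v : Qubits n}
    (hv : v ∈ primitive n u) : (raise n ^ j) v ∈ isotypic n u := by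
  refine apply_mem_isotypic (raise n ^ j) (raise_pow_permRep j) (fun w hw h => ?_)
    (by rwa [specht_eq_primitive])
  rw [specht_eq_primitive] at hw
  have h1 := lower_pow_raise_pow hw j 0 (by omega)
  rw [zero_add, h, map_zero, pow_zero, Module.End.one_apply] at h1
  refine (smul_eq_zero.mp h1.symm).resolve_left ?_
  refine Nat.cast_ne_zero.mpr ?_
  exact mul_ne_zero (fun h => absurd (Nat.descFactorial_eq_zero_iff_lt.mp h) (by omega))
    (fun h => absurd (Nat.descFactorial_eq_zero_iff_lt.mp h) (by omega))

theorem inner_permRep_swap_left (p q : Fin n) (ψ φ : Qubits n) :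
    inner ℂ (permRep n (Equiv.swap p q) ψ) φ = inner ℂ ψ (permRep n (Equiv.swap p q) φ) := by
  rw [← inner_permRep (Equiv.swap p q), permRep_swap_swap]

/-- Antisymmetrizing the argument of an equivariant map does not change the inner product of its
value with an antisymmetric vector. -/
theorem exists_antisymmOn_inner_eq {x y : ℕ} {a b : Fin y → Fin n}
    (hab : Function.Injective (Sum.elim a b))
    (Φ : (specht n x).toSubmodule →ₗ[ℂ] Qubits n)
    (hΦ : IsEquivariant Φ)
    {ψ : Qubits n} (hψ : AntisymmOn a b univ ψ) (z : (specht n x).toSubmodule)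
    (s : Finset (Fin y)) :
    ∃ z' : (specht n x).toSubmodule, AntisymmOn a b s (z' : Qubits n) ∧
      inner ℂ (Φ z') ψ = inner ℂ (Φ z) ψ := by
  obtain ⟨ha, hb, hne⟩ := Sum.elim_injective.mp hab
  induction s using Finset.induction_on with
  | empty => exact ⟨z, fun i hi => by simp at hi, rfl⟩
  | insert i s hi ih =>
    obtain ⟨z', hz', hin⟩ := ih
    let σz : (specht n x).toSubmodule :=
      ⟨permRep n (Equiv.swap (a i) (b i)) z', (specht n x).apply_mem_toSubmodule _ z'.2⟩
    -- The projection onto the antisymmetric vectors of column `i`; it preserves antisymmetry in the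
    -- earlier columns because the transpositions of disjoint columns commute.
    refine ⟨(1 / 2 : ℂ) • (z' - σz), fun k hk => ?_, ?_⟩
    · rw [Submodule.coe_smul, Submodule.coe_sub, map_smul, map_sub, ← smul_neg]
      congr 1
      change _ - permRep n _ (permRep n _ _) = -(_ - permRep n _ _)
      rcases mem_insert.mp hk with rfl | hk
      · rw [permRep_swap_swap]
        abel
      · have hki : k ≠ i := fun h => hi (h ▸ hk)
        rw [permRep_comm (swap_comm_of_disjoint (fun h => hki (ha h)) (hne _ _)
          (fun h => hne _ _ h.symm) (fun h => hki (hb h))), hz' k hk, map_neg]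
        abel
    · have h1 : inner ℂ (Φ σz) ψ = -inner ℂ (Φ z') ψ := by
        rw [hΦ _ z' σz rfl, inner_permRep_swap_left, hψ i (mem_univ i), inner_neg_right]
      rw [map_smul, map_sub, inner_smul_left, inner_sub_left, h1, hin]
      rw [map_div₀, map_one, map_ofNat]
      ring

/-- For `v` a polytabloid with `y` columns, `z` may be antisymmetrized in these columns; but `z` has
weight `x < y`, so it becomes zero. Together with `inner_raise_pow_eq_zero_of_gt` this separates the
isotypic components without Schur's lemma. -/
theorem inner_raise_pow_eq_zero_of_lt {x y j : ℕ} (hxy : x < y) {v : Qubits n}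
    (hv : v ∈ primitive n y) (Φ : (specht n x).toSubmodule →ₗ[ℂ] Qubits n)
    (hΦ : IsEquivariant Φ)
    (z : (specht n x).toSubmodule) : inner ℂ (Φ z) ((raise n ^ j) v) = 0 := by
  rw [← specht_eq_primitive] at hv
  induction hv using Submodule.span_induction with
  | mem v hv =>
    obtain ⟨a, b, hab, rfl⟩ := hv
    obtain ⟨z', hz', hin⟩ := exists_antisymmOn_inner_eq hab Φ hΦ
      ((polytabloid_antisymmOn hab).raise_pow j) z univ
    have : z' = 0 :=
      Subtype.ext (eq_zero_of_antisymmOn hab hz' (specht_le_primitive n x z'.2).1 hxy)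
    rw [← hin, this, map_zero, inner_zero_left]
  | zero => simp
  | add v w _ _ hv hw => rw [map_add, inner_add_right, hv, hw, add_zero]
  | smul c v _ hv => rw [map_smul, inner_smul_right, hv, mul_zero]

/-- For `z` a polytabloid with `x` columns, `Φ z` is antisymmetric in them. After moving `F^j`
across as `E^j`, the left vector is still antisymmetric, so it is supported on weights at least `x`,
while `v` has weight `y < x`. -/
theorem inner_raise_pow_eq_zero_of_gt {x y j : ℕ} (hxy : y < x) {v : Qubits n}
    (hv : v ∈ primitive n y) (Φ : (specht n x).toSubmodule →ₗ[ℂ] Qubits n)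
    (hΦ : IsEquivariant Φ)
    (z : (specht n x).toSubmodule) : inner ℂ (Φ z) ((raise n ^ j) v) = 0 := by
  obtain ⟨z, hz⟩ := z
  have hz₀ := hz
  induction hz using Submodule.span_induction with
  | mem z hz =>
    obtain ⟨a, b, hab, rfl⟩ := hz
    have h1 : AntisymmOn a b univ (Φ ⟨polytabloid a b, hz₀⟩) := fun i hi => by
      rw [← hΦ _ _ (-(⟨polytabloid a b, hz₀⟩ : (specht n x).toSubmodule)) (polytabloid_antisymmOn hab i hi).symm, map_neg]
    rw [← inner_lower_pow_left, inner_eq_sum]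
    refine sum_eq_zero fun w _ => ?_
    by_cases hw : weight w = y
    · have : ((lower n ^ j) (Φ ⟨polytabloid a b, hz₀⟩)) w = 0 := by
        by_contra hne
        have := le_weight_of_antisymmOn hab (h1.lower_pow j) hne
        omega
      rw [this, map_zero, zero_mul]
    · rw [hv.1 w hw, mul_zero]
  | zero =>
    have : Φ ⟨0, hz₀⟩ = 0 := Φ.map_zero
    rw [this, inner_zero_left]
  | add z z' hz hz' h h' =>
    have : Φ ⟨z + z', hz₀⟩ = Φ ⟨z, hz⟩ + Φ ⟨z', hz'⟩ := Φ.map_add ⟨z, hz⟩ ⟨z', hz'⟩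
    rw [this, inner_add_left, h hz, h' hz', add_zero]
  | smul c z hz h =>
    have : Φ ⟨c • z, hz₀⟩ = c • Φ ⟨z, hz⟩ := Φ.map_smul c ⟨z, hz⟩
    rw [this, inner_smul_left, h hz, mul_zero]

theorem raise_pow_mem_isotypic_orthogonal {x y j : ℕ} (hxy : x ≠ y) {v : Qubits n}
    (hv : v ∈ primitive n y) : (raise n ^ j) v ∈ (isotypic n x)ᗮ := by
  rw [Submodule.mem_orthogonal]
  intro φ hφ
  refine isotypic_induction (motive := fun φ => inner ℂ φ ((raise n ^ j) v) = 0) hφ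
    (fun Φ hΦ z => ?_) (inner_zero_left _) fun φ φ' h h' => by rw [inner_add_left, h, h', add_zero]
  rcases lt_or_gt_of_ne hxy with h | h
  · exact inner_raise_pow_eq_zero_of_lt h hv Φ hΦ z
  · exact inner_raise_pow_eq_zero_of_gt h hv Φ hΦ z

/-- The projection of a sum of raised primitive vectors onto an isotypic component. -/
theorem starProjection_isotypic {m : ℕ} (hm : m + m ≤ n) {v : ℕ → Qubits n}
    (hv : ∀ u, v u ∈ primitive n u) (x : ℕ) :
    (isotypic n x).starProjection (∑ u ∈ range (m + 1), (raise n ^ (m - u)) (v u)) =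
      if x ≤ m then (raise n ^ (m - x)) (v x) else 0 := by
  rw [map_sum]
  have h1 : ∀ u ∈ range (m + 1), (isotypic n x).starProjection ((raise n ^ (m - u)) (v u)) =
      if u = x then (raise n ^ (m - x)) (v x) else 0 := by
    intro u hu
    have hu := mem_range.mp hu
    split_ifs with hux
    · subst hux
      exact Submodule.starProjection_eq_self_iff.mpr
        (raise_pow_mem_isotypic (by omega) (hv u))
    · exact (Submodule.starProjection_apply_eq_zero_iff _).mpr
        (raise_pow_mem_isotypic_orthogonal (fun h => hux h.symm) (hv u))
  rw [sum_congr rfl h1, sum_ite_eq']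
  simp

end

/-! ### Coordinates indexed by subsets, and counting pairs of supports. -/

section

variable {n : ℕ}

/-- The word having letter `1` exactly at the positions in `S`. -/
def wordOf : Finset (Fin n) ≃ (Fin n → Fin 2) where
  toFun S j := if j ∈ S then 1 else 0
  invFun w := univ.filter fun j => w j = 1
  left_inv S := by
    ext j
    simp
  right_inv w := by
    funext j
    by_cases h : w j = 1
    · simp [h]
    · simp only [mem_filter, mem_univ, h, and_false, if_false]
      omega

theorem wordOf_apply (S : Finset (Fin n)) (j : Fin n) : wordOf S j = if j ∈ S then 1 else 0 := rfl

theorem flip_wordOf {j : Fin n} {T : Finset (Fin n)} (hj : j ∉ T) :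
    flip j (wordOf T) = wordOf (insert j T) := by
  funext i
  by_cases h : i = j
  · subst h
    simp [wordOf_apply, hj]
  · simp [flip_of_ne h, wordOf_apply, h]

/-- A superset `S` is reached from `T` once for each order in which the `a` elements of `S \ T` are
added. -/
theorem lower_pow_apply_wordOf (a : ℕ) (ψ : Qubits n) (T : Finset (Fin n)) :
    (lower n ^ a) ψ (wordOf T) =
      (a.factorial : ℂ) * ∑ S with T ⊆ S ∧ S.card = T.card + a, ψ (wordOf S) := by
  induction a generalizing T with
  | zero =>
    have : (univ.filter fun S => T ⊆ S ∧ S.card = T.card + 0) = {T} := by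
      ext S
      simp only [mem_filter, mem_univ, true_and, mem_singleton, add_zero]
      constructor
      · rintro ⟨h1, h2⟩
        exact (eq_of_subset_of_card_le h1 h2.le).symm
      · rintro rfl
        simp
    rw [this]
    simp
  | succ a ih =>
    rw [pow_succ', Module.End.mul_apply, lower_apply]
    have h1 : ∀ j, (if wordOf T j = 0 then ((lower n ^ a) ψ) (flip j (wordOf T)) else 0) =
        (a.factorial : ℂ) * ∑ S with T ⊆ S ∧ S.card = T.card + (a + 1),
          if j ∈ S \ T then ψ (wordOf S) else 0 := by
      intro j
      by_cases hj : j ∈ T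
      · simp [wordOf_apply, hj]
      · rw [if_pos (by simp [wordOf_apply, hj]), flip_wordOf hj, ih, ← sum_filter, filter_filter]
        congr 1
        refine sum_congr ?_ fun _ _ => rfl
        ext S
        simp only [mem_filter, mem_univ, true_and, card_insert_of_notMem hj, insert_subset_iff,
          mem_sdiff, hj, not_false_eq_true, and_true]
        constructor
        · rintro ⟨⟨h1, h2⟩, h3⟩
          exact ⟨⟨h2, by omega⟩, h1⟩
        · rintro ⟨⟨h2, h3⟩, h1⟩
          exact ⟨⟨h1, h2⟩, by omega⟩
    rw [sum_congr rfl fun j _ => h1 j, ← mul_sum, sum_comm, Nat.factorial_succ, Nat.cast_mul,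
      mul_comm ((a + 1 : ℕ) : ℂ), mul_assoc, mul_sum (a := ((a + 1 : ℕ) : ℂ))]
    congr 1
    refine sum_congr rfl fun S hS => ?_
    obtain ⟨hTS, hc⟩ := (mem_filter.mp hS).2
    rw [sum_ite_mem, univ_inter, sum_const, nsmul_eq_mul, card_sdiff_of_subset hTS, hc,
      Nat.add_sub_cancel_left]

/-- The norm of `E^a ψ` for `ψ` proportional to the sum of the basis vectors over a family of
`m`-element sets. -/
theorem inner_lower_pow_self {m r a : ℕ} (hm : r + a = m) {F : Finset (Finset (Fin n))}
    (hF : ∀ S ∈ F, S.card = m) {c : ℂ} {ψ : Qubits n}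
    (hψ : ∀ S, ψ (wordOf S) = if S ∈ F then c else 0) :
    inner ℂ ((lower n ^ a) ψ) ((lower n ^ a) ψ) =
      starRingEnd ℂ c * c * (a.factorial : ℂ) ^ 2 *
        ((∑ S ∈ F, ∑ S' ∈ F, (S ∩ S').card.choose r : ℕ) : ℂ) := by
  have h1 : ∀ T : Finset (Fin n), ((lower n ^ a) ψ) (wordOf T) =
      if T.card = r then (a.factorial : ℂ) * c * ((F.filter fun S => T ⊆ S).card : ℂ) else 0 := by
    intro T
    rw [lower_pow_apply_wordOf, sum_congr rfl fun S _ => hψ S, sum_ite, sum_const_zero, add_zero,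
      sum_const, nsmul_eq_mul, filter_filter]
    by_cases hT : T.card = r
    · have : (univ.filter fun S => (T ⊆ S ∧ S.card = T.card + a) ∧ S ∈ F) =
          F.filter fun S => T ⊆ S := by
        ext S
        simp only [mem_filter, mem_univ, true_and]
        constructor
        · rintro ⟨⟨h1, _⟩, h2⟩
          exact ⟨h2, h1⟩
        · rintro ⟨h1, h2⟩
          exact ⟨⟨h2, by rw [hF S h1, hT, hm]⟩, h1⟩
      rw [this, if_pos hT]
      ring
    · have : (univ.filter fun S => (T ⊆ S ∧ S.card = T.card + a) ∧ S ∈ F) = ∅ := by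
        ext S
        simp only [mem_filter, mem_univ, true_and, notMem_empty, iff_false]
        rintro ⟨⟨_, h1⟩, h2⟩
        rw [hF S h2] at h1
        omega
      rw [this, if_neg hT]
      simp
  -- Double counting of triples `(T, S, S')` with `T ⊆ S ∩ S'` of size `r`.
  have h2 : ∑ T : Finset (Fin n) with T.card = r, (F.filter fun S => T ⊆ S).card ^ 2 =
      ∑ S ∈ F, ∑ S' ∈ F, (S ∩ S').card.choose r := by
    simp only [sq, card_filter, sum_mul_sum]
    rw [sum_comm]
    refine sum_congr rfl fun S _ => ?_
    rw [sum_comm]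
    refine sum_congr rfl fun S' _ => ?_
    rw [← card_powersetCard, card_eq_sum_ones, sum_filter]
    rw [← sum_subset (subset_univ (powersetCard r (S ∩ S')))]
    · refine sum_congr rfl fun T hT => ?_
      rw [mem_powersetCard, subset_inter_iff] at hT
      simp [hT]
    · intro T _ hT
      rw [mem_powersetCard, subset_inter_iff] at hT
      by_cases hc : T.card = r
      · simp only [hc, and_true, if_true] at hT ⊢
        by_cases hS : T ⊆ S
        · have hS' : ¬T ⊆ S' := fun h => hT ⟨hS, h⟩
          simp [hS']
        · simp [hS]
      · simp [hc]
  rw [inner_eq_sum, ← Equiv.sum_comp wordOf, ← h2, Nat.cast_sum, mul_sum, sum_filter]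
  refine sum_congr rfl fun T _ => ?_
  rw [h1]
  split_ifs
  · simp only [map_mul, map_natCast]
    push_cast
    ring
  · simp

/-- The sets of size `m` meeting `K` in `L`. -/
def setFamily (K L : Finset (Fin n)) (m : ℕ) : Finset (Finset (Fin n)) :=
  univ.filter fun S => S ∩ K = L ∧ S.card = m

theorem mem_setFamily {K L S : Finset (Fin n)} {m : ℕ} :
    S ∈ setFamily K L m ↔ S ∩ K = L ∧ S.card = m := by
  simp [setFamily]

/-- A member is determined by its trace outside `K`, an arbitrary `M`-subset of the complement of `K
∪ U`. -/
theorem card_setFamily_disjoint {K L U : Finset (Fin n)} (hLK : L ⊆ K) (hU : Disjoint U K)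
    (M : ℕ) : ((setFamily K L (L.card + M)).filter fun S => Disjoint U S).card =
      (n - K.card - U.card).choose M := by
  have hR : (univ \ (K ∪ U)).card = n - K.card - U.card := by
    rw [card_sdiff_of_subset (subset_univ _), card_union_of_disjoint hU.symm, card_univ,
      Fintype.card_fin, Nat.sub_sub]
  rw [← hR, ← card_powersetCard]
  have hdisj : ∀ D ∈ powersetCard M (univ \ (K ∪ U)), Disjoint L D := by
    intro D hD
    rw [mem_powersetCard] at hD
    refine disjoint_left.mpr fun j hj hjD => ?_
    have := hD.1 hjD
    simp [hLK hj] at this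
  symm
  refine card_bij' (fun D _ => L ∪ D) (fun S _ => S \ K) ?_ ?_ ?_ ?_
  · intro D hD
    have hd := hdisj D hD
    rw [mem_powersetCard] at hD
    rw [mem_filter, mem_setFamily]
    refine ⟨⟨?_, by rw [card_union_of_disjoint hd, hD.2]⟩, ?_⟩
    · ext j
      have h1 := @hD.1 j
      have h2 := @hLK j
      simp only [mem_sdiff, mem_univ, true_and, mem_union, not_or, mem_inter] at h1 ⊢
      tauto
    · refine disjoint_left.mpr fun j hj hjD => ?_
      have h1 := @hD.1 j
      have h2 := disjoint_left.mp hU hj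
      have h3 := @hLK j
      simp only [mem_sdiff, mem_univ, true_and, mem_union, not_or] at h1 hjD
      tauto
  · intro S hS
    rw [mem_filter, mem_setFamily] at hS
    obtain ⟨⟨h1, h2⟩, h3⟩ := hS
    rw [mem_powersetCard]
    constructor
    · intro j hj
      have h4 : j ∈ U → j ∉ S := fun h => disjoint_left.mp h3 h
      simp only [mem_sdiff, mem_univ, true_and, mem_union, not_or] at hj ⊢
      tauto
    · have := card_sdiff_add_card_inter S K
      rw [h1, h2] at this
      omega
  · intro D hD
    rw [mem_powersetCard] at hD
    ext j
    have h1 := @hD.1 j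
    have h2 := @hLK j
    simp only [mem_sdiff, mem_univ, true_and, mem_union, not_or] at h1 ⊢
    tauto
  · intro S hS
    rw [mem_filter, mem_setFamily] at hS
    conv_lhs => rw [← hS.1.1]
    ext j
    simp only [mem_sdiff, mem_union, mem_inter]
    tauto

theorem card_setFamily {K L : Finset (Fin n)} (hLK : L ⊆ K) (M : ℕ) :
    (setFamily K L (L.card + M)).card = (n - K.card).choose M := by
  simpa using card_setFamily_disjoint hLK (disjoint_empty_left K) M

/-- Count pairs `(U, S')` with `U ⊆ S \ S'` of size `r`. All members agree on `K`, so `U` must be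
one of the `r`-subsets of the `M`-element set `S \ K`, and then `S'` has to avoid `U`. This product
form is why differences are used instead of intersections. -/
theorem sum_choose_card_sdiff {K L S : Finset (Fin n)} (hLK : L ⊆ K) {M : ℕ}
    (hS : S ∈ setFamily K L (L.card + M)) (r : ℕ) :
    ∑ S' ∈ setFamily K L (L.card + M), (S \ S').card.choose r =
      M.choose r * (n - K.card - r).choose M := by
  have h1 : ∀ S' : Finset (Fin n), (S \ S').card.choose r =
      ∑ U ∈ powersetCard r S, if Disjoint U S' then 1 else 0 := by
    intro S'
    rw [← card_powersetCard, ← card_filter]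
    congr 1
    ext U
    simp only [mem_powersetCard, mem_filter, subset_sdiff]
    tauto
  rw [sum_congr rfl fun S' _ => h1 S', sum_comm]
  have h2 : ∀ U ∈ powersetCard r S,
      (∑ S' ∈ setFamily K L (L.card + M), if Disjoint U S' then 1 else 0) =
        if Disjoint U K then (n - K.card - r).choose M else 0 := by
    intro U hU
    rw [mem_powersetCard] at hU
    rw [← card_filter]
    split_ifs with hUK
    · rw [card_setFamily_disjoint hLK hUK, hU.2]
    · rw [card_eq_zero, filter_eq_empty_iff]
      intro S' hS' hd
      obtain ⟨j, hjU, hjK⟩ := not_disjoint_iff.mp hUK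
      rw [mem_setFamily] at hS hS'
      have : j ∈ S' ∩ K := by
        rw [hS'.1, ← hS.1]
        exact mem_inter.mpr ⟨hU.1 hjU, hjK⟩
      exact disjoint_left.mp hd hjU (mem_inter.mp this).1
  rw [sum_congr rfl h2, ← sum_filter, sum_const, smul_eq_mul]
  congr 1
  have h3 : (powersetCard r S).filter (fun U => Disjoint U K) = powersetCard r (S \ K) := by
    ext U
    simp only [mem_powersetCard, mem_filter, subset_sdiff]
    tauto
  rw [h3, card_powersetCard]
  rw [mem_setFamily] at hS
  have := card_sdiff_add_card_inter S K
  rw [hS.1, hS.2] at this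
  congr 1
  omega

theorem dicke_apply (r M : ℕ) (w : Fin r → Fin 2) :
    dicke r M w = if weight w = M then ((Real.sqrt (r.choose M) : ℂ))⁻¹ else 0 := by
  have : (∑ v : Fin r → Fin 2 with (univ.filter fun j => v j = 1).card = M, ket v) w =
      if weight w = M then 1 else 0 := by
    rw [WithLp.ofLp_sum, Finset.sum_apply]
    simp only [ket, PiLp.single_apply]
    rw [sum_ite_eq]
    exact if_congr (by simp [weight]) rfl rfl
  simp only [dicke, PiLp.smul_apply, this, smul_eq_mul]
  split_ifs <;> simp

/-- The coordinates of the state `Ξ`. -/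
theorem xi_wordOf {m k l : ℕ} (h : Admissible n m k l) (S : Finset (Fin n)) :
    xi h (wordOf S) = if S ∈ setFamily (univ.filter fun j => j.val < k)
        (univ.filter fun j => j.val < l) m
      then ((Real.sqrt ((n - k).choose (m - l)) : ℂ))⁻¹ else 0 := by
  have hk := h.k_le
  have hl := h.l_le_k
  have hlm := h.l_le_m
  set K : Finset (Fin n) := univ.filter fun j => j.val < k
  set L : Finset (Fin n) := univ.filter fun j => j.val < l
  have hcast : k + (n - k) = n := Nat.add_sub_cancel' hk
  have hL : L.card = l := by
    rw [Fin.card_filter_val_lt]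
    omega
  have h1 : ketOnesZeros k l (fun i => wordOf S (Fin.cast hcast (Fin.castAdd (n - k) i))) =
      if S ∩ K = L then 1 else 0 := by
    simp only [ketOnesZeros, ket, PiLp.single_apply]
    congr 1
    rw [eq_iff_iff, funext_iff, Finset.ext_iff]
    constructor
    · intro h j
      by_cases hj : j.val < k
      · have := h ⟨j, hj⟩
        have he : Fin.cast hcast (Fin.castAdd (n - k) ⟨j.val, hj⟩) = j := rfl
        rw [he, wordOf_apply] at this
        simp only [K, L, mem_inter, mem_filter, mem_univ, true_and, hj, and_true]
        by_cases hjS : j ∈ S <;> by_cases hjl : j.val < l <;> simp_all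
      · simp only [K, L, mem_inter, mem_filter, mem_univ, true_and, hj, and_false, false_iff]
        omega
    · intro h i
      have := h (Fin.cast hcast (Fin.castAdd (n - k) i))
      have hi : (Fin.cast hcast (Fin.castAdd (n - k) i)).val = i.val := rfl
      simp only [K, L, mem_inter, mem_filter, mem_univ, true_and, hi, i.isLt, and_true] at this
      rw [wordOf_apply]
      simp only [this]
  have h2 : weight (fun j => wordOf S (Fin.cast hcast (Fin.natAdd k j))) = (S \ K).card := by
    unfold weight
    refine card_bij (fun j _ => Fin.cast hcast (Fin.natAdd k j)) ?_ ?_ ?_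
    · intro j hj
      simp only [K, mem_sdiff, mem_filter, mem_univ, true_and]
      refine ⟨by simpa [wordOf_apply] using hj, by simp⟩
    · intro i _ j _ hij
      simpa using hij
    · intro j hj
      simp only [K, mem_sdiff, mem_filter, mem_univ, true_and, not_lt] at hj
      have he : Fin.cast hcast (Fin.natAdd k ⟨j.val - k, by omega⟩) = j := by
        ext
        simp [hj.2]
      refine ⟨⟨j.val - k, by omega⟩, ?_, he⟩
      simp only [mem_filter, mem_univ, true_and, he]
      simp [wordOf_apply, hj.1]
  have h3 : xi h (wordOf S) =
      ketOnesZeros k l (fun i => wordOf S (Fin.cast hcast (Fin.castAdd (n - k) i))) *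
      dicke (n - k) (m - l) (fun j => wordOf S (Fin.cast hcast (Fin.natAdd k j))) := rfl
  rw [h3, h1, dicke_apply, h2]
  have h4 := card_sdiff_add_card_inter S K
  by_cases hS : S ∩ K = L
  · rw [hS, hL] at h4
    have h5 : (S \ K).card = m - l ↔ S.card = m := by omega
    simp [mem_setFamily, hS, h5]
  · simp [mem_setFamily, hS]

end

/-! ### Alternating binomial sums and the triangular inversion. -/

/-- Inclusion-exclusion for the `c`-subsets of an `A`-set that contain a given `d`-set; the
induction uses Pascal's rule. The lower index `A - c` replaces `c - d`, so that the value is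
correctly zero when `d > c`. -/
theorem alternating_sum_choose_mul_choose (d : ℕ) {A c : ℕ} (hd : d ≤ A) (hc : c ≤ A) :
    ∑ p ∈ range (d + 1), (-1 : ℂ) ^ p * (d.choose p * (A - p).choose c) =
      (A - d).choose (A - c) := by
  induction d generalizing A with
  | zero => simp [Nat.choose_symm hc]
  | succ d ih =>
    rcases hc.eq_or_lt with rfl | hlt
    · rw [sum_eq_single 0]
      · simp
      · intro p _ hp
        rw [Nat.choose_eq_zero_of_lt (by omega : c - p < c)]
        simp
      · simp
    · have h1 := ih (A := A) (by omega) hc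
      have h2 := ih (A := A - 1) (by omega) (by omega)
      have h3 : (A - d).choose (A - c) =
          (A - 1 - d).choose (A - 1 - c) + (A - (d + 1)).choose (A - c) := by
        rw [show A - d = (A - 1 - d) + 1 by omega, show A - c = (A - 1 - c) + 1 by omega,
          Nat.choose_succ_succ, show A - (d + 1) = A - 1 - d by omega]
      rw [h3, Nat.cast_add, ← h2] at h1
      rw [← sub_eq_iff_eq_add'.mpr h1, sum_range_succ' _ (d + 1),
        sum_range_succ' (fun p => (-1 : ℂ) ^ p * (d.choose p * (A - p).choose c)) d]
      have h4 : ∑ p ∈ range (d + 1), (-1 : ℂ) ^ (p + 1) *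
          (d.choose (p + 1) * (A - (p + 1)).choose c) =
          ∑ p ∈ range d, (-1 : ℂ) ^ (p + 1) * (d.choose (p + 1) * (A - (p + 1)).choose c) := by
        rw [sum_range_succ]
        simp
      rw [← h4, add_sub_right_comm, ← sum_sub_distrib]
      congr 1
      · refine sum_congr rfl fun p _ => ?_
        rw [Nat.choose_succ_succ, show A - (p + 1) = A - 1 - p by omega, pow_succ]
        push_cast
        ring
      · simp

/-- Passing from intersections to differences of `m`-element sets. -/
theorem alternating_sum_choose_inter {m r j : ℕ} (hr : r ≤ m) (hj : j ≤ m) :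
    ∑ q ∈ range (r + 1), (-1 : ℂ) ^ q * ((m - q).choose (r - q) * j.choose q) =
      (m - j).choose r := by
  have h1 := alternating_sum_choose_mul_choose j hj (Nat.sub_le m r)
  rw [Nat.sub_sub_self hr] at h1
  rw [← h1]
  have h2 : ∀ q ∈ range (r + 1), (-1 : ℂ) ^ q * ((m - q).choose (r - q) * j.choose q) =
      (-1 : ℂ) ^ q * (j.choose q * (m - q).choose (m - r)) := by
    intro q hq
    have hq := mem_range.mp hq
    rw [← Nat.choose_symm (by omega : r - q ≤ m - q), show m - q - (r - q) = m - r by omega,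
      mul_comm (Nat.cast _ : ℂ)]
  rw [sum_congr rfl h2]
  rcases le_total r j with h | h
  · refine sum_subset (range_mono (by omega)) fun q hq hq' => ?_
    simp only [mem_range] at hq hq'
    rw [Nat.choose_eq_zero_of_lt (by omega : m - q < m - r)]
    simp
  · refine (sum_subset (range_mono (by omega)) fun q hq hq' => ?_).symm
    simp only [mem_range] at hq hq'
    rw [Nat.choose_eq_zero_of_lt (by omega : j < q)]
    simp

theorem sum_range_eq_sum_shift {u r : ℕ} (hu : u ≤ r) (f : ℕ → ℂ) (hf : ∀ q < u, f q = 0) :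
    ∑ q ∈ range (r + 1), f q = ∑ p ∈ range (r - u + 1), f (u + p) := by
  rw [show r + 1 = u + (r - u + 1) by omega, sum_range_add, sum_eq_zero, zero_add]
  exact fun q hq => hf q (mem_range.mp hq)

/-- The combination of `alternating_sum_choose_inter`, applied to the eigenvalues of `F^(m-q)
E^(m-q)` divided by `(m-q)!^2`. Terms with `q < u` vanish, which makes the result triangular in `u`
and `r`. -/
theorem alternating_sum_eigenvalue {n m u r : ℕ} (hm : m + m ≤ n) (hr : r ≤ m) (hum : u ≤ m) :
    ∑ q ∈ range (r + 1), (-1 : ℂ) ^ q * ((m - q).choose (r - q) *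
        ((m - u).choose (m - q) * (n - u - q).choose (m - q))) =
      if u ≤ r then (-1 : ℂ) ^ u * ((m - u).choose (r - u) * (n - u - r).choose (m - u))
      else 0 := by
  split_ifs with hu
  · rw [sum_range_eq_sum_shift hu]
    · have h1 := alternating_sum_choose_mul_choose (r - u) (A := n - 2 * u) (c := n - u - m)
        (by omega) (by omega)
      rw [show n - 2 * u - (r - u) = n - u - r by omega,
        show n - 2 * u - (n - u - m) = m - u by omega] at h1
      rw [← h1, mul_sum, mul_sum]
      refine sum_congr rfl fun p hp => ?_
      have hp := mem_range.mp hp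
      have h2 : (m - (u + p)).choose (r - (u + p)) * (m - u).choose (m - (u + p)) =
          (m - u).choose (r - u) * (r - u).choose p := by
        rw [Nat.choose_mul (by omega), ← Nat.choose_symm (by omega : p ≤ m - u),
          show m - u - p = m - (u + p) by omega, show r - u - p = r - (u + p) by omega, mul_comm]
      have h3 : (n - u - (u + p)).choose (m - (u + p)) = (n - 2 * u - p).choose (n - u - m) := by
        rw [← Nat.choose_symm (by omega), show n - u - (u + p) - (m - (u + p)) = n - u - m by omega,
          show n - u - (u + p) = n - 2 * u - p by omega]
      have h2' : ((m - (u + p)).choose (r - (u + p)) : ℂ) * (m - u).choose (m - (u + p)) =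
          (m - u).choose (r - u) * (r - u).choose p := by exact_mod_cast h2
      rw [h3, ← mul_assoc ((m - (u + p)).choose (r - (u + p)) : ℂ), h2', pow_add]
      ring
    · intro q hq
      rw [Nat.choose_eq_zero_of_lt (by omega : m - u < m - q)]
      simp
  · refine sum_eq_zero fun q hq => ?_
    have hq := mem_range.mp hq
    rw [Nat.choose_eq_zero_of_lt (by omega : m - u < m - q)]
    simp

/-- The product of binomials equals `C(x, d) C(n - d, x)`, so this is the previous alternating sum
with both parameters equal to `x`. -/
theorem alternating_sum_choose_sub_two_mul {n x : ℕ} (hx : x ≤ n) :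
    ∑ d ∈ range (x + 1), (-1 : ℂ) ^ d * ((n - 2 * d).choose (x - d) * (n - d).choose d) = 1 := by
  have h1 := alternating_sum_choose_mul_choose x hx hx
  rw [Nat.choose_self, Nat.cast_one] at h1
  refine Eq.trans (sum_congr rfl fun d hd => ?_) h1
  have hd := mem_range.mp hd
  by_cases hnd : x ≤ n - d
  · have h2 : (n - d).choose x * x.choose d = (n - d).choose d * (n - 2 * d).choose (x - d) := by
      rw [Nat.choose_mul (by omega), show n - d - d = n - 2 * d by omega]
    have h2' : ((n - d).choose x : ℂ) * x.choose d =
        (n - d).choose d * (n - 2 * d).choose (x - d) := by exact_mod_cast h2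
    rw [mul_comm (x.choose d : ℂ), h2', mul_comm ((n - d).choose d : ℂ)]
  · rw [Nat.choose_eq_zero_of_lt (by omega : n - d < x)]
    rcases lt_or_ge (n - d) d with h | h
    · rw [Nat.choose_eq_zero_of_lt h]
      simp
    · rw [Nat.choose_eq_zero_of_lt (by omega : n - 2 * d < x - d)]
      simp

/-- Inversion of the triangular system satisfied by the probabilities, in cumulative form. -/
theorem sum_range_eq_of_triangular {n m x : ℕ} (hm : m + m ≤ n) (hx : x ≤ m) {P Q : ℕ → ℂ}
    (h : ∀ r ≤ m, ∑ u ∈ range (m + 1), P u * (if u ≤ r then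
      (-1 : ℂ) ^ u * ((m - u).choose (r - u) * (n - u - r).choose (m - u)) else 0) = Q r) :
    ∑ u ∈ range (x + 1), P u = ∑ r ∈ range (x + 1),
      ((n - 2 * r).choose (x - r) / (n - 2 * r).choose (m - r) : ℂ) * ((-1) ^ r * Q r) := by
  -- The weights turn column `u` of the triangular matrix into the indicator of `u ≤ x`; the partial
  -- sum of `P` thus appears without solving for the individual values.
  have h1 : ∀ u ∈ range (m + 1), ∑ r ∈ range (x + 1),
      ((n - 2 * r).choose (x - r) / (n - 2 * r).choose (m - r) : ℂ) * ((-1) ^ r *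
        (if u ≤ r then (-1 : ℂ) ^ u * ((m - u).choose (r - u) * (n - u - r).choose (m - u))
          else 0)) = if u < x + 1 then 1 else 0 := by
    intro u hu
    have hu := mem_range.mp hu
    split_ifs with hux
    · rw [sum_range_eq_sum_shift (u := u) (by omega) _
        (fun q hq => by rw [if_neg (by omega)]; simp)]
      refine Eq.trans (sum_congr rfl fun d hd => ?_)
        (alternating_sum_choose_sub_two_mul (n := n - 2 * u) (x := x - u) (by omega))
      have hd := mem_range.mp hd
      have h2 : (n - u - (u + d)).choose (m - u) * (m - u).choose (u + d - u) =
          (n - 2 * u - d).choose d * (n - 2 * (u + d)).choose (m - (u + d)) := by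
        rw [Nat.choose_mul (by omega)]
        congr 2 <;> omega
      have h2' : ((n - u - (u + d)).choose (m - u) : ℂ) * (m - u).choose (u + d - u) =
          (n - 2 * u - d).choose d * (n - 2 * (u + d)).choose (m - (u + d)) := by
        exact_mod_cast h2
      have h3 : ((n - 2 * (u + d)).choose (m - (u + d)) : ℂ) ≠ 0 :=
        Nat.cast_ne_zero.mpr (Nat.choose_pos (by omega)).ne'
      have h4 : ((-1 : ℂ) ^ u) * (-1) ^ u = 1 := by
        rw [← mul_pow]
        simp
      rw [if_pos (by omega), mul_comm ((m - u).choose (u + d - u) : ℂ), h2',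
        show n - 2 * u - 2 * d = n - 2 * (u + d) by omega, show x - u - d = x - (u + d) by omega,
        pow_add]
      field_simp
      linear_combination ((n - 2 * (u + d)).choose (x - (u + d)) : ℂ) *
        (n - 2 * u - d).choose d * h4
    · refine sum_eq_zero fun r hr => ?_
      have hr := mem_range.mp hr
      rw [if_neg (by omega)]
      simp
  have h2 : ∑ r ∈ range (x + 1),
      ((n - 2 * r).choose (x - r) / (n - 2 * r).choose (m - r) : ℂ) * ((-1) ^ r * Q r) =
      ∑ u ∈ range (m + 1), P u * if u < x + 1 then 1 else 0 := by
    rw [← sum_congr rfl fun u hu => congrArg (P u * ·) (h1 u hu)]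
    simp only [mul_sum]
    rw [sum_comm]
    refine sum_congr rfl fun r hr => ?_
    have hr := mem_range.mp hr
    rw [← h r (by omega), mul_sum, mul_sum]
    refine sum_congr rfl fun u _ => ?_
    ring
  rw [h2]
  simp only [mul_ite, mul_one, mul_zero]
  rw [← sum_filter]
  congr 1
  ext u
  simp only [mem_range, mem_filter]
  omega

/-! ### Hypergeometric terms. -/

theorem risingFactorial_succ (a : ℂ) (r : ℕ) :
    risingFactorial a (r + 1) = risingFactorial a r * (a + r) := prod_range_succ _ _

theorem risingFactorial_succ' (a : ℂ) (r : ℕ) :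
    risingFactorial a (r + 1) = a * risingFactorial (a + 1) r := by
  unfold risingFactorial
  rw [prod_range_succ', mul_comm]
  congr 1
  · simp
  · refine prod_congr rfl fun j _ => ?_
    push_cast
    ring

theorem risingFactorial_neg_natCast (a r : ℕ) :
    risingFactorial (-(a : ℂ)) r = (-1) ^ r * (a.descFactorial r : ℂ) := by
  induction r with
  | zero => simp [risingFactorial]
  | succ r ih =>
    rw [risingFactorial_succ, ih, Nat.descFactorial_succ, Nat.cast_mul, pow_succ]
    rcases le_or_gt r a with h | h
    · rw [Nat.cast_sub h]
      ring
    · rw [Nat.descFactorial_eq_zero_iff_lt.mpr h]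
      simp

theorem risingFactorial_one (r : ℕ) : risingFactorial 1 r = r.factorial := by
  induction r with
  | zero => simp [risingFactorial]
  | succ r ih =>
    rw [risingFactorial_succ, ih, Nat.factorial_succ]
    push_cast
    ring

/-- The factor of a hypergeometric term not involving the first two numerator parameters. -/
noncomputable def termWeight (M N b₁ b₂ b₃ : ℂ) (r : ℕ) : ℂ :=
  risingFactorial (-M) r * risingFactorial (-N) r / (risingFactorial 1 r *
    (risingFactorial b₁ r * (risingFactorial b₂ r * risingFactorial b₃ r)))

/-- The summation range depends on `m` only, so sums over several `x ≤ m` can be exchanged with it.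
-/
theorem hypergeom_eq_sum {x m : ℕ} (hx : x ≤ m) (a M N b₁ b₂ b₃ : ℂ) :
    hypergeom [-(x : ℂ), a, -M, -N] [b₁, b₂, b₃] 1 =
      ∑ r ∈ range (m + 1),
        risingFactorial (-(x : ℂ)) r * risingFactorial a r * termWeight M N b₁ b₂ b₃ r := by
  unfold hypergeom
  rw [tsum_eq_sum (s := range (m + 1))]
  · refine sum_congr rfl fun r _ => ?_
    simp only [List.map_cons, List.map_nil, List.prod_cons, List.prod_nil, one_pow, termWeight]
    ring
  · intro r hr
    rw [mem_range] at hr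
    have : risingFactorial (-(x : ℂ)) r = 0 := by
      rw [risingFactorial_neg_natCast, Nat.descFactorial_eq_zero_iff_lt.mpr (by omega)]
      simp
    simp [this]

/-- Statement 4 for a single index `r`, stripped of the factor common to both sides: the right side
telescopes in `x`. -/
theorem sum_range_choose_mul_risingFactorial {n x : ℕ} (hx : x ≤ n) (r : ℕ) :
    ∑ u ∈ range (x + 1), (n.choose u : ℂ) * (((n : ℂ) - 2 * u + 1) / ((n : ℂ) - u + 1)) *
        (risingFactorial (-(u : ℂ)) r * risingFactorial (u - n - 1) r) =
      (n.choose x : ℂ) * (risingFactorial (-(x : ℂ)) r * risingFactorial (x - n) r) := by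
  induction x with
  | zero =>
    have h1 : (n : ℂ) + 1 ≠ 0 := Nat.cast_add_one_ne_zero n
    rcases r with _ | r
    · simp [risingFactorial, h1]
    · simp [risingFactorial_succ']
  | succ x ih =>
    rw [sum_range_succ, ih (by omega)]
    have h1 : (n : ℂ) - x ≠ 0 := by
      rw [← Nat.cast_sub (by omega)]
      exact Nat.cast_ne_zero.mpr (by omega)
    have h2 : (n.choose (x + 1) : ℂ) * (x + 1) = n.choose x * (n - x) := by
      have := Nat.choose_succ_right_eq n x
      rw [← Nat.cast_sub (by omega)]
      exact_mod_cast this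
    -- Both `h3` and `h4` come from splitting off the first or the last factor: `(a)_r (a + r) = a
    -- (a + 1)_r`.
    have h3 : risingFactorial (-((x + 1 : ℕ) : ℂ)) r * (-(x + 1) + r) =
        -(x + 1) * risingFactorial (-(x : ℂ)) r := by
      have h := risingFactorial_succ (-((x + 1 : ℕ) : ℂ)) r
      rw [risingFactorial_succ'] at h
      have e : -((x + 1 : ℕ) : ℂ) + 1 = -(x : ℂ) := by push_cast; ring
      rw [e] at h
      rw [mul_comm (-((x : ℂ) + 1))]
      push_cast at h ⊢
      linear_combination -h
    have h4 : risingFactorial ((x : ℂ) - n) r * (x - n + r) =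
        (x - n) * risingFactorial (((x + 1 : ℕ) : ℂ) - n) r := by
      have h := risingFactorial_succ ((x : ℂ) - n) r
      rw [risingFactorial_succ'] at h
      have e : ((x : ℂ) - n) + 1 = ((x + 1 : ℕ) : ℂ) - n := by push_cast; ring
      rw [e] at h
      exact h.symm
    have e1 : ((x + 1 : ℕ) : ℂ) - n - 1 = (x : ℂ) - n := by push_cast; ring
    have e2 : (n : ℂ) - ((x + 1 : ℕ) : ℂ) + 1 = n - x := by push_cast; ring
    have e3 : (n : ℂ) - 2 * ((x + 1 : ℕ) : ℂ) + 1 = n - 2 * x - 1 := by push_cast; ring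
    rw [e1, e2, e3]
    generalize risingFactorial (-((x + 1 : ℕ) : ℂ)) r = A at *
    generalize risingFactorial (-(x : ℂ)) r = A' at *
    generalize risingFactorial (((x + 1 : ℕ) : ℂ) - n) r = B at *
    generalize risingFactorial ((x : ℂ) - n) r = B' at *
    field_simp
    linear_combination (-(A' * B')) * h2 + (n.choose (x + 1) : ℂ) * B' * h3 -
      (n.choose (x + 1) : ℂ) * A * h4

theorem choose_mul_descFactorial {a b r : ℕ} (hr : r ≤ b) :
    a.choose b * b.descFactorial r = a.descFactorial r * (a - r).choose (b - r) := by
  rcases le_or_gt b a with h | h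
  · rw [Nat.descFactorial_eq_factorial_mul_choose, Nat.descFactorial_eq_factorial_mul_choose,
      mul_left_comm, Nat.choose_mul hr, mul_assoc]
  · rw [Nat.choose_eq_zero_of_lt h]
    rcases lt_or_ge a r with h' | h'
    · rw [Nat.descFactorial_eq_zero_iff_lt.mpr h']
      simp
    · rw [Nat.choose_eq_zero_of_lt (by omega : a - r < b - r)]
      simp

/-- The two falling factorials of `n` and `n - r` do not involve `x`; they cancel in the quotient of
the identities for `x` and for `m`. -/
theorem choose_mul_descFactorial_mul_descFactorial {n x r : ℕ} (hr : r ≤ x) (hrx : r + x ≤ n) :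
    n.choose x * (x.descFactorial r * (n - x).descFactorial r) =
      n.descFactorial r * (n - r).descFactorial r * (n - 2 * r).choose (x - r) := by
  have h1 : (n - r).choose (x - r) = (n - r).choose (n - x) := by
    rw [← Nat.choose_symm (by omega : x - r ≤ n - r)]
    congr 1
    omega
  rw [← mul_assoc, choose_mul_descFactorial hr, mul_assoc, h1,
    choose_mul_descFactorial (by omega : r ≤ n - x), ← mul_assoc,
    ← Nat.choose_symm (by omega : n - x - r ≤ n - r - r)]
  congr 2 <;> omega

theorem choose_mul_descFactorial_sub {a M r : ℕ} (hM : M ≤ a) (hr : r ≤ a) :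
    a.choose M * (a - M).descFactorial r = a.descFactorial r * (a - r).choose M := by
  rcases le_or_gt r (a - M) with h | h
  · rw [← Nat.choose_symm hM, choose_mul_descFactorial h,
      ← Nat.choose_symm (by omega : a - M - r ≤ a - r)]
    congr 2
    omega
  · rw [Nat.descFactorial_eq_zero_iff_lt.mpr h, Nat.choose_eq_zero_of_lt (by omega : a - r < M)]
    simp

/-- The terms of the cumulative distribution function are those of a hypergeometric series. -/
theorem choose_mul_hypergeom_term {n m x r a M N : ℕ} (hm : m + m ≤ n) (hx : x ≤ m) (hr : r ≤ x)
    (ha : M + N = a) :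
    (a.choose M : ℂ) * (n.choose x / n.choose m) *
        (risingFactorial (-(x : ℂ)) r * risingFactorial (-((n - x : ℕ) : ℂ)) r *
          termWeight M N (-(m : ℂ)) (-((n - m : ℕ) : ℂ)) (-(a : ℂ)) r) =
      ((n - 2 * r).choose (x - r) / (n - 2 * r).choose (m - r) : ℂ) *
        ((-1) ^ r * (M.choose r * (a - r).choose M)) := by
  have h1 : (n.choose x : ℂ) * (x.descFactorial r * (n - x).descFactorial r) =
      n.descFactorial r * (n - r).descFactorial r * (n - 2 * r).choose (x - r) := by
    exact_mod_cast choose_mul_descFactorial_mul_descFactorial hr (by omega : r + x ≤ n)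
  have h2 : (n.choose m : ℂ) * (m.descFactorial r * (n - m).descFactorial r) =
      n.descFactorial r * (n - r).descFactorial r * (n - 2 * r).choose (m - r) := by
    exact_mod_cast choose_mul_descFactorial_mul_descFactorial (hr.trans hx) (by omega : r + m ≤ n)
  have hsign : ((-1 : ℂ) ^ r) * (-1) ^ r = 1 := by
    rw [← mul_pow]
    simp
  have hne : ∀ {p q : ℕ}, q ≤ p → (p.descFactorial q : ℂ) ≠ 0 := fun hpq =>
    Nat.cast_ne_zero.mpr fun h => absurd (Nat.descFactorial_eq_zero_iff_lt.mp h) (by omega)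
  have hs : ((-1 : ℂ) ^ r) ≠ 0 := pow_ne_zero _ (by norm_num)
  have hc1 : (n.choose m : ℂ) ≠ 0 := Nat.cast_ne_zero.mpr (Nat.choose_pos (by omega)).ne'
  have hc2 : ((n - 2 * r).choose (m - r) : ℂ) ≠ 0 :=
    Nat.cast_ne_zero.mpr (Nat.choose_pos (by omega)).ne'
  have hd1 := hne (hr.trans hx)
  have hd2 := hne (by omega : r ≤ n - m)
  have hd3 := hne (by omega : r ≤ n)
  have hd4 := hne (by omega : r ≤ n - r)
  have hf : (r.factorial : ℂ) ≠ 0 := Nat.cast_ne_zero.mpr r.factorial_ne_zero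
  simp only [termWeight, risingFactorial_neg_natCast, risingFactorial_one]
  rcases le_or_gt r a with hra | hra
  · have h3 : (a.choose M : ℂ) * N.descFactorial r = a.descFactorial r * (a - r).choose M := by
      have := choose_mul_descFactorial_sub (a := a) (M := M) (by omega) hra
      rw [show a - M = N by omega] at this
      exact_mod_cast this
    have h4 : (M.descFactorial r : ℂ) = r.factorial * M.choose r := by
      exact_mod_cast Nat.descFactorial_eq_factorial_mul_choose M r
    have hd5 := hne hra
    have h5 : (n.choose x : ℂ) / n.choose m * (x.descFactorial r * (n - x).descFactorial r /
        (m.descFactorial r * (n - m).descFactorial r)) =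
        (n - 2 * r).choose (x - r) / (n - 2 * r).choose (m - r) := by
      rw [div_mul_div_comm, h1, h2, mul_div_mul_left _ _ (mul_ne_zero hd3 hd4)]
    have h6 : (a.choose M : ℂ) * (M.descFactorial r * N.descFactorial r /
        (r.factorial * a.descFactorial r)) = M.choose r * (a - r).choose M := by
      rw [h4]
      field_simp
      linear_combination (M.choose r : ℂ) * h3
    rw [← h5, ← h6]
    field_simp
  -- Here the denominator factor `(-a)_r` is zero, but so is `(-M)_r`, since `M ≤ a < r`; both sides
  -- vanish.
  · rw [Nat.descFactorial_eq_zero_iff_lt.mpr (by omega : M < r),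
      Nat.choose_eq_zero_of_lt (by omega : M < r)]
    simp

/-! ### The probabilities of the state and the final formulas. -/

section

variable {n : ℕ}

theorem weight_wordOf (S : Finset (Fin n)) : weight (wordOf S) = S.card :=
  congrArg card (wordOf.symm_apply_apply S)

theorem xi_mem_weightSpace {m k l : ℕ} (h : Admissible n m k l) : xi h ∈ weightSpace n m := by
  intro w hw
  obtain ⟨S, rfl⟩ := wordOf.surjective w
  rw [weight_wordOf] at hw
  rw [xi_wordOf, if_neg fun hS => hw (mem_setFamily.mp hS).2]

theorem card_filter_val_lt_of_le {l : ℕ} (hl : l ≤ n) :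
    (univ.filter fun j : Fin n => j.val < l).card = l := by
  rw [Fin.card_filter_val_lt]
  omega

theorem filter_val_lt_mono {k l : ℕ} (hl : l ≤ k) :
    (univ.filter fun j : Fin n => j.val < l) ⊆ univ.filter fun j => j.val < k :=
  monotone_filter_right _ fun _ _ hj => lt_of_lt_of_le hj hl

theorem conj_inv_sqrt_mul_self (a : ℕ) :
    starRingEnd ℂ ((Real.sqrt a : ℂ))⁻¹ * ((Real.sqrt a : ℂ))⁻¹ = (a : ℂ)⁻¹ := by
  rw [map_inv₀, Complex.conj_ofReal, ← mul_inv, ← Complex.ofReal_mul,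
    Real.mul_self_sqrt (Nat.cast_nonneg a), Complex.ofReal_natCast]

/-- The family of supports of the words occurring in `Ξ`. -/
def xiFamily (n m k l : ℕ) : Finset (Finset (Fin n)) :=
  setFamily (univ.filter fun j => j.val < k) (univ.filter fun j => j.val < l) m

theorem card_xiFamily {m k l : ℕ} (h : Admissible n m k l) :
    (xiFamily n m k l).card = (n - k).choose (m - l) := by
  have := card_setFamily (n := n) (K := univ.filter fun j => j.val < k)
    (L := univ.filter fun j => j.val < l)
    (filter_val_lt_mono h.l_le_k) (m - l)
  rwa [card_filter_val_lt_of_le h.k_le, card_filter_val_lt_of_le (h.l_le_k.trans h.k_le),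
    Nat.add_sub_cancel' h.l_le_m] at this

theorem sum_choose_card_sdiff_xiFamily {m k l : ℕ} (h : Admissible n m k l)
    {S : Finset (Fin n)} (hS : S ∈ xiFamily n m k l) (r : ℕ) :
    ∑ S' ∈ xiFamily n m k l, (S \ S').card.choose r =
      (m - l).choose r * (n - k - r).choose (m - l) := by
  have hm : m = (univ.filter fun j : Fin n => j.val < l).card + (m - l) := by
    rw [card_filter_val_lt_of_le (h.l_le_k.trans h.k_le), Nat.add_sub_cancel' h.l_le_m]
  rw [xiFamily, hm] at hS ⊢
  have := sum_choose_card_sdiff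
    (filter_val_lt_mono h.l_le_k) hS r
  rw [card_filter_val_lt_of_le h.k_le] at this
  rw [this, ← hm]

theorem choose_pos_of_admissible {m k l : ℕ} (h : Admissible n m k l) :
    0 < (n - k).choose (m - l) := by
  have h1 := h.add_le
  have h2 := h.k_le
  have h3 := h.l_le_m
  exact Nat.choose_pos (by omega)

theorem inner_xi_self {m k l : ℕ} (h : Admissible n m k l) : inner ℂ (xi h) (xi h) = 1 := by
  have hC : (((n - k).choose (m - l) : ℕ) : ℂ) ≠ 0 :=
    Nat.cast_ne_zero.mpr (choose_pos_of_admissible h).ne'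
  rw [inner_eq_sum, ← Equiv.sum_comp wordOf]
  have : ∀ S : Finset (Fin n), starRingEnd ℂ (xi h (wordOf S)) * xi h (wordOf S) =
      if S ∈ xiFamily n m k l then (((n - k).choose (m - l) : ℕ) : ℂ)⁻¹ else 0 := by
    intro S
    rw [xi_wordOf, xiFamily]
    split_ifs
    · exact conj_inv_sqrt_mul_self _
    · simp
  rw [sum_congr rfl fun S _ => this S, sum_ite_mem, univ_inter, sum_const, card_xiFamily h,
    nsmul_eq_mul, mul_inv_cancel₀ hC]

/-- The probabilities in terms of the primitive components of `Ξ`. -/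
theorem exists_pmf_eq {m k l : ℕ} (h : Admissible n m k l) (hmn : m + m ≤ n) :
    ∃ v : ℕ → Qubits n, (∀ u, v u ∈ primitive n u) ∧
      xi h = ∑ u ∈ range (m + 1), (raise n ^ (m - u)) (v u) ∧
      ∀ x, pmf h x = if x ≤ m then inner ℂ (xi h) ((raise n ^ (m - x)) (v x)) else 0 := by
  obtain ⟨v, hv, hxi⟩ := exists_sum_raise_pow (xi_mem_weightSpace h)
  refine ⟨v, hv, hxi, fun x => ?_⟩
  have := starProjection_isotypic hmn hv x
  rw [← hxi] at this
  rw [pmf, this]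
  split_ifs <;> simp

theorem pmf_eq_zero_of_lt {m k l x : ℕ} (h : Admissible n m k l) (hmn : m + m ≤ n) (hx : m < x) :
    pmf h x = 0 := by
  obtain ⟨v, _, _, hp⟩ := exists_pmf_eq h hmn
  rw [hp, if_neg (by omega)]

theorem sum_pmf {m k l : ℕ} (h : Admissible n m k l) (hmn : m + m ≤ n) :
    ∑ u ∈ range (m + 1), pmf h u = 1 := by
  obtain ⟨v, _, hxi, hp⟩ := exists_pmf_eq h hmn
  rw [← inner_xi_self h]
  refine Eq.trans ?_ (congrArg (inner ℂ (xi h)) hxi).symm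
  rw [inner_sum]
  refine sum_congr rfl fun u hu => ?_
  rw [hp, if_pos (by have := mem_range.mp hu; omega)]

/-- The moments `⟨Ξ|F^(m-q) E^(m-q)|Ξ⟩`, computed in two ways. -/
theorem sum_pmf_mul_choose {m k l q : ℕ} (h : Admissible n m k l) (hmn : m + m ≤ n)
    (hq : q ≤ m) :
    ∑ u ∈ range (m + 1),
        pmf h u * ((m - u).choose (m - q) * (n - u - q).choose (m - q)) =
      (((n - k).choose (m - l) : ℕ) : ℂ)⁻¹ *
        ∑ S ∈ xiFamily n m k l, ∑ S' ∈ xiFamily n m k l, ((S ∩ S').card.choose q : ℂ) := by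
  obtain ⟨v, hv, hxi, hp⟩ := exists_pmf_eq h hmn
  have h1 := inner_lower_pow_self (r := q) (a := m - q) (F := xiFamily n m k l) (by omega)
    (fun S hS => (mem_setFamily.mp hS).2) (xi_wordOf h)
  rw [conj_inv_sqrt_mul_self, inner_lower_pow_left] at h1
  have h2 : (raise n ^ (m - q)) ((lower n ^ (m - q)) (xi h)) = ∑ u ∈ range (m + 1),
      (((m - u).descFactorial (m - q) * (n - u - q).descFactorial (m - q) : ℕ) : ℂ) •
        (raise n ^ (m - u)) (v u) := by
    conv_lhs => rw [hxi, map_sum, map_sum]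
    refine sum_congr rfl fun u hu => ?_
    exact raise_pow_lower_pow_raise_pow (hv u) (by have := mem_range.mp hu; omega) hq hmn
  -- This factor occurs on both sides: from the two falling factorials in the eigenvalue, and from
  -- the square of the multiplicity in `E^(m-q) Ξ`.
  have hf : ((m - q).factorial : ℂ) ^ 2 ≠ 0 :=
    pow_ne_zero _ (Nat.cast_ne_zero.mpr (Nat.factorial_ne_zero _))
  rw [h2, inner_sum] at h1
  have h3 : ∀ u ∈ range (m + 1), inner ℂ (xi h)
      ((((m - u).descFactorial (m - q) * (n - u - q).descFactorial (m - q) : ℕ) : ℂ) •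
        (raise n ^ (m - u)) (v u)) = ((m - q).factorial : ℂ) ^ 2 *
      (pmf h u * ((m - u).choose (m - q) * (n - u - q).choose (m - q))) := by
    intro u hu
    rw [inner_smul_right, hp, if_pos (by have := mem_range.mp hu; omega),
      Nat.descFactorial_eq_factorial_mul_choose, Nat.descFactorial_eq_factorial_mul_choose]
    push_cast
    ring
  rw [sum_congr rfl h3, ← mul_sum] at h1
  refine mul_left_cancel₀ hf (h1.trans ?_)
  push_cast
  ring

/-- Sum the moment identities over `q` with coefficients `(-1)^q C(m - q, r - q)`. On the side of
the probabilities the matrix becomes triangular; on the combinatorial side intersections become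
differences, and the sum over `S'` no longer depends on `S`, so the average over `S` is that
constant. -/
theorem sum_pmf_mul_eigenvalue {m k l r : ℕ} (h : Admissible n m k l) (hmn : m + m ≤ n)
    (hr : r ≤ m) :
    ∑ u ∈ range (m + 1), pmf h u * (if u ≤ r then
      (-1 : ℂ) ^ u * ((m - u).choose (r - u) * (n - u - r).choose (m - u)) else 0) =
      (m - l).choose r * (n - k - r).choose (m - l) := by
  have hC : (((n - k).choose (m - l) : ℕ) : ℂ) ≠ 0 :=
    Nat.cast_ne_zero.mpr (choose_pos_of_admissible h).ne'
  have h1 : ∑ u ∈ range (m + 1), pmf h u * (if u ≤ r then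
      (-1 : ℂ) ^ u * ((m - u).choose (r - u) * (n - u - r).choose (m - u)) else 0) =
      ∑ q ∈ range (r + 1), (-1 : ℂ) ^ q * ((m - q).choose (r - q) *
        ∑ u ∈ range (m + 1),
          pmf h u * ((m - u).choose (m - q) * (n - u - q).choose (m - q))) := by
    simp only [mul_sum]
    rw [sum_comm]
    refine sum_congr rfl fun u hu => ?_
    rw [← alternating_sum_eigenvalue hmn hr (by have := mem_range.mp hu; omega), mul_sum]
    refine sum_congr rfl fun q _ => ?_
    ring
  have h2 : ∀ S ∈ xiFamily n m k l, ∀ S' ∈ xiFamily n m k l,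
      ∑ q ∈ range (r + 1), (-1 : ℂ) ^ q * ((m - q).choose (r - q) * (S ∩ S').card.choose q) =
        ((S \ S').card.choose r : ℂ) := by
    intro S hS S' _
    have hc := (mem_setFamily.mp hS).2
    have h4 := card_sdiff_add_card_inter S S'
    rw [alternating_sum_choose_inter hr (by omega)]
    congr 2
    omega
  rw [h1]
  have h3 : ∀ q ∈ range (r + 1), (-1 : ℂ) ^ q * ((m - q).choose (r - q) *
        ∑ u ∈ range (m + 1),
          pmf h u * ((m - u).choose (m - q) * (n - u - q).choose (m - q))) =
      (((n - k).choose (m - l) : ℕ) : ℂ)⁻¹ * ∑ S ∈ xiFamily n m k l, ∑ S' ∈ xiFamily n m k l,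
        (-1 : ℂ) ^ q * ((m - q).choose (r - q) * (S ∩ S').card.choose q) := by
    intro q hq
    rw [sum_pmf_mul_choose h hmn (by have := mem_range.mp hq; omega)]
    simp only [mul_sum]
    refine sum_congr rfl fun S _ => sum_congr rfl fun S' _ => ?_
    ring
  rw [sum_congr rfl h3, ← mul_sum, sum_comm]
  have h5 : ∀ S ∈ xiFamily n m k l, ∑ q ∈ range (r + 1), ∑ S' ∈ xiFamily n m k l,
        (-1 : ℂ) ^ q * ((m - q).choose (r - q) * (S ∩ S').card.choose q) =
      (m - l).choose r * (n - k - r).choose (m - l) := by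
    intro S hS
    rw [sum_comm, sum_congr rfl (h2 S hS)]
    exact_mod_cast sum_choose_card_sdiff_xiFamily h hS r
  rw [sum_congr rfl h5, sum_const, card_xiFamily h, nsmul_eq_mul, inv_mul_cancel_left₀ hC]

/-- The cumulative distribution function as a finite alternating sum. -/
theorem cdf_eq_sum {m k l x : ℕ} (h : Admissible n m k l) (hmn : m + m ≤ n) (hx : x ≤ m) :
    cdf h x = ∑ r ∈ range (x + 1),
      ((n - 2 * r).choose (x - r) / (n - 2 * r).choose (m - r) : ℂ) *
        ((-1) ^ r * ((m - l).choose r * (n - k - r).choose (m - l))) :=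
  sum_range_eq_of_triangular hmn hx fun _ hr => sum_pmf_mul_eigenvalue h hmn hr

theorem cdf_eq_cdf_min {m k l : ℕ} (h : Admissible n m k l) (hmn : m + m ≤ n) (x : ℕ) :
    cdf h x = cdf h (min x m) := by
  refine (sum_subset (range_mono (by omega)) fun u hu hu' => ?_).symm
  simp only [mem_range] at hu hu'
  exact pmf_eq_zero_of_lt h hmn (by omega)

theorem cdf_eq_hypergeom {m k l x : ℕ} (h : Admissible n m k l) (hmn : m + m ≤ n) (hx : x ≤ m)
    {M N : ℂ} (hM : M = (m : ℂ) - l) (hN : N = (n : ℂ) - m - k + l) :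
    cdf h x = ((n - k).choose (m - l) : ℂ) * ((n.choose x : ℂ) / (n.choose m : ℂ)) *
      hypergeom [-(x : ℂ), x - n, -M, -N] [-(m : ℂ), m - n, -M - N] 1 := by
  have hk := h.k_le
  have hl := h.l_le_m
  have hadd := h.add_le
  have eM : M = ((m - l : ℕ) : ℂ) := by rw [hM, Nat.cast_sub hl]
  have eN : N = ((n + l - (m + k) : ℕ) : ℂ) := by
    rw [hN, Nat.cast_sub hadd]
    push_cast
    ring
  have e1 : (x : ℂ) - n = -((n - x : ℕ) : ℂ) := by rw [Nat.cast_sub (by omega)]; ring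
  have e2 : (m : ℂ) - n = -((n - m : ℕ) : ℂ) := by rw [Nat.cast_sub (by omega)]; ring
  have e3 : -M - N = -((n - k : ℕ) : ℂ) := by rw [hM, hN, Nat.cast_sub hk]; ring
  rw [cdf_eq_sum h hmn hx, hypergeom_eq_sum le_rfl, e3, e1, e2, eM, eN, mul_sum]
  refine sum_congr rfl fun r hr => ?_
  exact (choose_mul_hypergeom_term hmn hx (by have := mem_range.mp hr; omega) (by omega)).symm

/-- The parameters other than the first two enter only through `termWeight`, so the identity holds
for arbitrary values of them. -/
theorem sum_choose_mul_hypergeom {m x : ℕ} (hmn : m ≤ n) (hx : x ≤ m) (M N b₁ b₂ b₃ : ℂ) :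
    ∑ u ∈ range (x + 1), (n.choose u : ℂ) * (((n : ℂ) - 2 * u + 1) / ((n : ℂ) - u + 1)) *
        hypergeom [-(u : ℂ), u - n - 1, -M, -N] [b₁, b₂, b₃] 1 =
      (n.choose x : ℂ) * hypergeom [-(x : ℂ), x - n, -M, -N] [b₁, b₂, b₃] 1 := by
  rw [hypergeom_eq_sum hx, sum_congr rfl fun u hu =>
    congrArg _ (hypergeom_eq_sum (m := m) (by have := mem_range.mp hu; omega) _ _ _ _ _ _)]
  simp only [mul_sum]
  rw [sum_comm]
  refine sum_congr rfl fun r _ => ?_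
  rw [← mul_assoc, ← sum_range_choose_mul_risingFactorial (hx.trans hmn), sum_mul]
  refine sum_congr rfl fun u _ => ?_
  ring

end

end Qubits

theorem theorem4p8 (n m k l : ℕ) (h : Admissible n m k l) (hmn : m ≤ n - m)
    (M N : ℂ) (hM : M = (m : ℂ) - l) (hN : N = (n : ℂ) - m - k + l) :
    (∀ x : ℕ, cdf h x = cdf h (min x m)) ∧
    (∀ x : ℕ, x ≤ m →
      cdf h x = ((n - k).choose (m - l) : ℂ) * ((n.choose x : ℂ) / (n.choose m : ℂ)) *
        hypergeom [-(x : ℂ), x - n, -M, -N] [-(m : ℂ), m - n, -M - N] 1) ∧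
    cdf h m = 1 ∧
    (∀ x : ℕ, x ≤ m →
      ∑ u ∈ Finset.range (x + 1),
        (n.choose u : ℂ) * (((n : ℂ) - 2 * u + 1) / ((n : ℂ) - u + 1)) *
          hypergeom [-(u : ℂ), u - n - 1, -M, -N] [-(m : ℂ), m - n, -M - N] 1 =
      (n.choose x : ℂ) *
        hypergeom [-(x : ℂ), x - n, -M, -N] [-(m : ℂ), m - n, -M - N] 1) := by
  have hm := h.m_le
  have hmm : m + m ≤ n := by omega
  exact ⟨Qubits.cdf_eq_cdf_min h hmm, fun x hx => Qubits.cdf_eq_hypergeom h hmm hx hM hN,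
    Qubits.sum_pmf h hmm, fun x hx => Qubits.sum_choose_mul_hypergeom hm hx M N _ _ _⟩
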